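/- \textbf{Universal approximation for energy-based neural networks.} Let $G$ be a real $N\times N$ matrix that is skew-symmetric or non-degenerate (the skew-symmetric case, $G=S$, is that of Hamiltonian neural networks; there $S$ may be degenerate). Let $K\subset\mathbb{R}^N$ be compact (the phase space), and let $H:\mathbb{R}^N\to\mathbb{R}$ be an energy function that is differentiable at every point of $K$ and for which the right-hand side $u\mapsto G\,\frac{\partial H}{\partial u}(u)$ of the equation $\frac{du}{dt}=G\,\frac{\partial H}{\partial u}$ is Lipschitz continuous on $K$. Let the activation function $\sigma:\mathbb{R}\to\mathbb{R}$, $\sigma\neq 0$, belong to $S^1_2(\mathbb{R})$, that is, $\sigma$ is $C^1$ and $\sigma,\sigma'\in L^2(\mathbb{R})$. A neural network with activation $\sigma$ is a function $H_{\mathrm{NN}}(u)=\sum_{j=1}^{r}c_j\,\sigma(w_j\cdot u+b_j)$ with $r\ge 0$, $w_j\in\mathbb{R}^N$ and $b_j,c_j\in\mathbb{R}$. Then: (1) For every $\varepsilon>0$ there is a neural network $H_{\mathrm{NN}}$ with activation $\sigma$ such that $$\left\|G\frac{\partial H}{\partial u}-G\frac{\partial H_{\mathrm{NN}}}{\partial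 u}\right\|_{L^2(K)}<\varepsilon ,$$ where $L^2(K)$ is taken with respect to Lebesgue measure on $K$ and the Euclidean norm on $\mathbb{R}^N$. (2) If in addition $H$ is $C^\infty$ on $\mathbb{R}^N$ and $\sigma$ is $C^n$ for some $n\in\{0,1,2,\dots\}\cup\{\infty\}$, then for every integer $m$ with $0\le m\le n$ and every $\varepsilon>0$ there is a neural network $H_{\mathrm{NN}}$ with activation $\sigma$ which is of class $C^n$ and satisfies $\|D^kH(u)-D^kH_{\mathrm{NN}}(u)\|<\varepsilon$ for all $u\in K$ and all $0\le k\le m$. In particular, if $\sigma$ is $C^\infty$, then $H$ can be approximated by $C^\infty$ neural networks in the $C^\infty$ topology on $K$. -/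

import Mathlib

open MeasureTheory
open scoped NNReal ENNReal ContDiff

/-- The class `S^m_p(ℝ)`: the `C^m` functions on the real line all of whose derivatives of order
at most `m` are in `L^p` with respect to Lebesgue measure (for a `C^m` function the weak
derivatives are the classical ones). -/
structure IsSobolevSmooth (m : ℕ) (p : ℝ≥0∞) (σ : ℝ → ℝ) : Prop where
  contDiff : ContDiff ℝ m σ
  memLp : ∀ k : ℕ, k ≤ m → MemLp (iteratedDeriv k σ) p volume

/-- The parameters of a feed-forward neural network `ℝ^N → ℝ` with one hidden layer. -/
structure NeuralNetwork (N : ℕ) where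
  /-- number of hidden units -/
  width : ℕ
  /-- input weights of the hidden units -/
  weight : Fin width → EuclideanSpace ℝ (Fin N)
  /-- biases of the hidden units -/
  bias : Fin width → ℝ
  /-- output weights -/
  coeff : Fin width → ℝ

/-- The function `u ↦ ∑ j, c j * σ (⟪w j, u⟫ + b j)` computed by a network with activation
function `σ`. -/
noncomputable def NeuralNetwork.toFun {N : ℕ} (net : NeuralNetwork N) (σ : ℝ → ℝ)
    (u : EuclideanSpace ℝ (Fin N)) : ℝ :=
  ∑ j, net.coeff j * σ (inner ℝ (net.weight j) u + net.bias j)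

/-- The right-hand side `G ∂H/∂u` of the energy-based equation `du/dt = G ∂H/∂u`. -/
noncomputable def energyField {N : ℕ} (G : Matrix (Fin N) (Fin N) ℝ)
    (H : EuclideanSpace ℝ (Fin N) → ℝ) (u : EuclideanSpace ℝ (Fin N)) :
    EuclideanSpace ℝ (Fin N) :=
  Matrix.toEuclideanLin G (gradient H u)

/-!
The two assertions rest on two independent approximation theorems.

*Networks are dense in `C^∞` for `Cᵐ`-convergence on compact sets*
(`IsSobolevSmooth.exists_mem_ridgeSpan_iteratedFDeriv`). Since `σ` and `σ'` are in `L²`, `σ` tends to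
`0` at `+∞`, so a mollification `f` of `σ` is not a polynomial: for each `k` there is `b` with
`f⁽ᵏ⁾(b) ≠ 0`. In `C(B, ℝ)`, with `B` compact, a closed subspace containing all functions
`σ (h ⟪w, u⟫ + b)` contains `f (h ⟪w, u⟫ + b)`, hence the derivatives in `h` at `h = 0`, which are the
`f⁽ᵏ⁾(b) ⟪w, u⟫ᵏ`, hence the exponential of `⟪w, u⟫`. The exponentials span an algebra that separates
points, and uniform density follows from the Stone–Weierstrass theorem. It is upgraded to
`Cᵐ`-density by convolution: a compactly supported smooth function is `Cᵐ`-close to its convolution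
with an approximate identity, all derivatives of the convolution may be put on the function, so the
approximate identity may be replaced by a uniformly close network, and the convolution of a network
with a function is a `Cᵐ`-limit of networks.

*The energy field of `H` is a uniform limit on `K` of energy fields of smooth functions*
(`exists_contDiff_energyField_approx`). Here `H` is only differentiable at the points of `K`, with no
uniformity, so that Whitney's extension theorem does not apply, and only the derivatives of `H` along
the range of `Gᵀ`, which is written as `ker Q`, are known to be continuous on `K`. By a partition of
unity, and after subtracting linear functions, it is enough to treat an `H` whose derivative along
`ker Q` is at most `ε` on `K`, and to find smooth functions that converge to `H` uniformly on `K` and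
whose derivatives along `ker Q` are at most `L`, for any `L > ε`. These are mollifications of
`coneEnvelope Q L δ K H`, the largest function below `H` on `K` whose slope, at scales less than `δ`
and in the `δ`-neighbourhood of `K`, is at most `L` along `ker Q` and at most of order `1 / δ` in
other directions. The convergence of the envelopes as `δ → 0` is a maximum principle
(`iInf_sub_coneEnvelope_nonpos`).

Both theorems together give uniform, hence `L²`, approximation of the energy field by those of
networks.
-/

section

open Filter Topology Metric ContinuousLinearMap

/-! ### Derivatives of convolutions, and integrals in closed subspaces -/

section Convolution

theorem convolution_lsmul_continuousLinearEquiv_comp {E F F' : Type*} [NormedAddCommGroup E]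
    [MeasurableSpace E] [NormedAddCommGroup F] [NormedSpace ℝ F] [NormedAddCommGroup F']
    [NormedSpace ℝ F'] {μ : Measure E} (f : E → ℝ) (g : E → F) (e : F ≃L[ℝ] F') :
    convolution f (e ∘ g) (lsmul ℝ ℝ) μ = e ∘ convolution f g (lsmul ℝ ℝ) μ := by
  ext x
  simp only [convolution_def, Function.comp]
  rw [← ContinuousLinearEquiv.integral_comp_comm]
  simp

variable {E F : Type*} [NormedAddCommGroup E] [NormedSpace ℝ E] [FiniteDimensional ℝ E]
  [MeasurableSpace E] [BorelSpace E] [NormedAddCommGroup F] [NormedSpace ℝ F]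
  {μ : Measure E} [μ.IsAddHaarMeasure]

/-- Differentiation of a convolution `f ⋆ g` through the factor `g`, when either factor has compact
support. Mathlib has the case in which it is `g`; if it is `f`, then `g` may be cut off far away. -/
theorem hasFDerivAt_convolution_lsmul {f : E → ℝ} {g : E → F} (hf : LocallyIntegrable f μ)
    (hc : HasCompactSupport f ∨ HasCompactSupport g) (hg : ContDiff ℝ 1 g) (x : E) :
    HasFDerivAt (convolution f g (lsmul ℝ ℝ) μ) (convolution f (fderiv ℝ g) (lsmul ℝ ℝ) μ x) x := by
  have key : ∀ g : E → F, HasCompactSupport g → ContDiff ℝ 1 g →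
      HasFDerivAt (convolution f g (lsmul ℝ ℝ) μ)
        (convolution f (fderiv ℝ g) (lsmul ℝ ℝ) μ x) x := by
    intro g hgc hg
    have h := hgc.hasFDerivAt_convolution_right (lsmul ℝ ℝ) hf hg x
    convert h using 1
    simp only [convolution_def]
    refine integral_congr_ae (Eventually.of_forall fun y => ?_)
    ext v
    simp
  rcases hc with hfc | hgc
  · obtain ⟨R, hR⟩ := hfc.isCompact.isBounded.subset_closedBall (0 : E)
    let χ : ContDiffBump (0 : E) := ⟨|R| + ‖x‖ + 2, |R| + ‖x‖ + 3, by positivity, by linarith⟩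
    have hsm : ∀ x' ∈ ball x 1, ∀ y, f y ≠ 0 → x' - y ∈ ball (0 : E) χ.rIn := by
      intro x' hx' y hy
      have h1 := hR (subset_tsupport f hy)
      simp only [mem_closedBall, mem_ball, dist_eq_norm, sub_zero] at h1 hx' ⊢
      have h2 : ‖x' - y‖ ≤ ‖x' - x‖ + ‖x‖ + ‖y‖ := by
        calc ‖x' - y‖ = ‖(x' - x) + x - y‖ := by congr 1; abel
          _ ≤ _ := (norm_sub_le _ _).trans (by gcongr; exact norm_add_le _ _)
      have : R ≤ |R| := le_abs_self R
      change _ < |R| + ‖x‖ + 2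
      linarith
    have h := key (fun z => χ z • g z) (χ.hasCompactSupport.smul_right) (χ.contDiff.smul hg)
    have e1 : convolution f g (lsmul ℝ ℝ) μ =ᶠ[𝓝 x]
        convolution f (fun z => χ z • g z) (lsmul ℝ ℝ) μ := by
      filter_upwards [ball_mem_nhds x one_pos] with x' hx'
      simp only [convolution_def]
      refine integral_congr_ae (Eventually.of_forall fun y => ?_)
      by_cases hy : f y = 0
      · simp [hy]
      · simp [χ.one_of_mem_closedBall (ball_subset_closedBall (hsm x' hx' y hy))]
    have e2 : convolution f (fderiv ℝ g) (lsmul ℝ ℝ) μ x =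
        convolution f (fderiv ℝ fun z => χ z • g z) (lsmul ℝ ℝ) μ x := by
      simp only [convolution_def]
      refine integral_congr_ae (Eventually.of_forall fun y => ?_)
      by_cases hy : f y = 0
      · simp [hy]
      · have hb := hsm x (mem_ball_self one_pos) y hy
        have : (fun z => χ z • g z) =ᶠ[𝓝 (x - y)] g := by
          filter_upwards [isOpen_ball.mem_nhds hb] with z hz
          simp [χ.one_of_mem_closedBall (ball_subset_closedBall hz)]
        simp only [this.fderiv_eq]
    rw [e2]
    exact h.congr_of_eventuallyEq e1
  · exact key g hgc hg

set_option maxSynthPendingDepth 3 in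
theorem iteratedFDeriv_convolution_lsmul {f : E → ℝ} {g : E → F} (hf : LocallyIntegrable f μ)
    (hc : HasCompactSupport f ∨ HasCompactSupport g) {m : ℕ} (hg : ContDiff ℝ m g) {k : ℕ}
    (hk : k ≤ m) :
    iteratedFDeriv ℝ k (convolution f g (lsmul ℝ ℝ) μ) =
      convolution f (iteratedFDeriv ℝ k g) (lsmul ℝ ℝ) μ := by
  induction k with
  | zero =>
    rw [iteratedFDeriv_zero_eq_comp, iteratedFDeriv_zero_eq_comp]
    exact (convolution_lsmul_continuousLinearEquiv_comp f g
      (continuousMultilinearCurryFin0 ℝ E F).symm.toContinuousLinearEquiv).symm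
  | succ k ih =>
    rw [iteratedFDeriv_succ_eq_comp_left, iteratedFDeriv_succ_eq_comp_left, ih (by omega)]
    have h1 : ContDiff ℝ 1 (iteratedFDeriv ℝ k g) :=
      hg.iteratedFDeriv_right (by norm_cast; omega)
    have h2 : fderiv ℝ (convolution f (iteratedFDeriv ℝ k g) (lsmul ℝ ℝ) μ) =
        convolution f (fderiv ℝ (iteratedFDeriv ℝ k g)) (lsmul ℝ ℝ) μ := by
      ext1 x
      exact (hasFDerivAt_convolution_lsmul hf (hc.imp id fun h => h.iteratedFDeriv k) h1 x).fderiv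
    rw [h2]
    exact (convolution_lsmul_continuousLinearEquiv_comp f _
      (continuousMultilinearCurryLeftEquiv ℝ (fun _ : Fin (k + 1) => E) F).symm.toContinuousLinearEquiv).symm

end Convolution

/-- A Bochner integral of a function with values in a closed subspace lies in that subspace. -/
theorem Submodule.integral_mem_of_isClosed {X E : Type*} [MeasurableSpace X] {μ : Measure X}
    [NormedAddCommGroup E] [NormedSpace ℝ E] [CompleteSpace E] (S : Submodule ℝ E)
    (hS : IsClosed (S : Set E)) {f : X → E} (hf : ∀ x, f x ∈ S) : ∫ x, f x ∂μ ∈ S := by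
  by_cases hi : Integrable f μ
  · have : IsClosed (S : Set E) := hS
    have h := S.mkQL.integral_comp_comm hi
    rw [← S.ker_mkQ, LinearMap.mem_ker]
    change S.mkQL (∫ x, f x ∂μ) = 0
    rw [← h]
    have : ∀ x, S.mkQL (f x) = 0 := fun x => (Submodule.Quotient.mk_eq_zero S).2 (hf x)
    simp [this]
  · rw [integral_undef hi]
    exact S.zero_mem

/-! ### Activation functions of class `S¹₂` and their mollifications -/

section Decay

/-- A `C¹` function with `σ, σ' ∈ L²` tends to `0` at `+∞`, because `σ²` and `(σ²)' = 2 σ σ'` are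
integrable. -/
theorem IsSobolevSmooth.tendsto_zero {σ : ℝ → ℝ} (hσ : IsSobolevSmooth 1 2 σ) :
    Tendsto σ atTop (𝓝 0) := by
  have h0 : MemLp σ 2 volume := by simpa using hσ.memLp 0 (by norm_num)
  have h1 : MemLp (deriv σ) 2 volume := by simpa using hσ.memLp 1 le_rfl
  have hd : Differentiable ℝ σ := hσ.contDiff.differentiable (by norm_num)
  have h2 : Tendsto (fun x => σ x ^ 2) atTop (𝓝 0) := by
    refine tendsto_zero_of_hasDerivAt_of_integrableOn_Ioi (a := 0) (f' := fun x => 2 * σ x * deriv σ x)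
      (fun x _ => ?_) ?_ h0.integrable_sq.integrableOn
    · simpa using! (hd x).hasDerivAt.pow 2
    · have := (h0.integrable_mul h1).const_mul 2
      refine Integrable.integrableOn ?_
      convert this using 2
      simp [mul_assoc]
  have h3 := h2.sqrt
  simp only [Real.sqrt_sq_eq_abs, Real.sqrt_zero] at h3
  exact (tendsto_zero_iff_abs_tendsto_zero _).2 h3

/-- Averaging over a compact set of translations preserves decay at `+∞`. -/
theorem tendsto_convolution_atTop_zero {φ σ : ℝ → ℝ} (hφ : Continuous φ) (hφc : HasCompactSupport φ)
    (hσ : Tendsto σ atTop (𝓝 0)) :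
    Tendsto (convolution σ φ (lsmul ℝ ℝ) volume) atTop (𝓝 0) := by
  obtain ⟨R, hR⟩ := hφc.isCompact.isBounded.subset_closedBall (0 : ℝ)
  have hint : Integrable φ := hφ.integrable_of_hasCompactSupport hφc
  set I := ∫ t, |φ t|
  have hI : 0 ≤ I := integral_nonneg fun t => abs_nonneg _
  rw [Metric.tendsto_atTop]
  intro ε hε
  obtain ⟨S, hS⟩ := Metric.tendsto_atTop.1 hσ (ε / (I + 1)) (by positivity)
  refine ⟨S + R, fun x hx => ?_⟩
  rw [dist_zero_right, convolution_lsmul_swap]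
  have hb : ∀ t, ‖σ (x - t) • φ t‖ ≤ ε / (I + 1) * |φ t| := by
    intro t
    rw [norm_smul, Real.norm_eq_abs (φ t)]
    by_cases ht : φ t = 0
    · simp [ht]
    · have h1 := hR (subset_tsupport φ ht)
      rw [mem_closedBall, dist_zero_right, Real.norm_eq_abs] at h1
      have h2 := hS (x - t) (by linarith [le_abs_self t])
      rw [dist_zero_right] at h2
      gcongr
  calc _ ≤ ∫ t, ε / (I + 1) * |φ t| :=
        norm_integral_le_of_norm_le (hint.abs.const_mul _) (Eventually.of_forall hb)
    _ = ε * (I / (I + 1)) := by rw [integral_const_mul]; ring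
    _ < ε * 1 := by
        gcongr
        rw [div_lt_one (by positivity)]
        linarith
    _ = ε := mul_one _

/-- A smooth function all of whose derivatives vanish at `+∞` has no identically vanishing
derivative unless it is itself zero. -/
theorem eq_zero_of_iteratedDeriv_eq_zero {f : ℝ → ℝ} (hf : ContDiff ℝ ∞ f)
    (hlim : ∀ k, Tendsto (iteratedDeriv k f) atTop (𝓝 0)) {k : ℕ} (hk : iteratedDeriv k f = 0) :
    f = 0 := by
  induction k with
  | zero => simpa using hk
  | succ k ih =>
    apply ih
    rw [iteratedDeriv_succ] at hk
    have hd : Differentiable ℝ (iteratedDeriv k f) :=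
      hf.differentiable_iteratedDeriv k (by exact_mod_cast ENat.natCast_lt_top k)
    ext x
    have hc : iteratedDeriv k f = fun _ => iteratedDeriv k f x := by
      ext y
      exact is_const_of_deriv_eq_zero hd (fun z => congrFun hk z) y x
    have := hlim k
    rw [hc] at this
    exact tendsto_nhds_unique tendsto_const_nhds this

/-- An activation function of class `S¹₂` that is not zero can be mollified to a smooth function
none of whose derivatives vanishes identically, i.e. to a smooth function that is not a
polynomial. -/
theorem IsSobolevSmooth.exists_mollification {σ : ℝ → ℝ} (hσ : IsSobolevSmooth 1 2 σ) (hσ0 : σ ≠ 0) :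
    ∃ φ : ℝ → ℝ, Continuous φ ∧ HasCompactSupport φ ∧
      ContDiff ℝ ∞ (convolution φ σ (lsmul ℝ ℝ) volume) ∧
      ∀ k, ∃ b, iteratedDeriv k (convolution φ σ (lsmul ℝ ℝ) volume) b ≠ 0 := by
  obtain ⟨x₀, hx₀⟩ := Function.ne_iff.1 hσ0
  have hcont : Continuous σ := hσ.contDiff.continuous
  obtain ⟨δ, hδ, hδ'⟩ := Metric.continuous_iff.1 hcont x₀ (|σ x₀| / 2) (by
    have : 0 < |σ x₀| := abs_pos.2 hx₀
    linarith)
  let φ : ContDiffBump (0 : ℝ) := ⟨δ / 2, δ, by linarith, by linarith⟩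
  have hφs : ContDiff ℝ ∞ (φ.normed volume) := φ.contDiff_normed
  have hφc : HasCompactSupport (φ.normed volume) := φ.hasCompactSupport_normed
  have hcomm : convolution (φ.normed volume) σ (lsmul ℝ ℝ) volume =
      convolution σ (φ.normed volume) (lsmul ℝ ℝ) volume := by
    ext x
    rw [convolution_lsmul_swap]
    simp [convolution_def, mul_comm]
  have hsm : ContDiff ℝ ∞ (convolution σ (φ.normed volume) (lsmul ℝ ℝ) volume) :=
    hφc.contDiff_convolution_right (n := ⊤) (lsmul ℝ ℝ) hcont.locallyIntegrable hφs
  have hder : ∀ k, iteratedDeriv k (convolution σ (φ.normed volume) (lsmul ℝ ℝ) volume) =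
      convolution σ (iteratedDeriv k (φ.normed volume)) (lsmul ℝ ℝ) volume := by
    intro k
    rw [iteratedDeriv_eq_equiv_comp, iteratedDeriv_eq_equiv_comp,
      iteratedFDeriv_convolution_lsmul (m := k) hcont.locallyIntegrable (Or.inr hφc)
        (hφs.of_le (by exact_mod_cast le_top)) le_rfl]
    exact (convolution_lsmul_continuousLinearEquiv_comp σ _
      (ContinuousMultilinearMap.piFieldEquiv ℝ (Fin k) ℝ).symm.toContinuousLinearEquiv).symm
  refine ⟨φ.normed volume, hφs.continuous, hφc, hcomm ▸ hsm, fun k => ?_⟩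
  rw [hcomm]
  by_contra! hcon
  have h0 := eq_zero_of_iteratedDeriv_eq_zero hsm (fun j => by
    rw [hder j]
    refine tendsto_convolution_atTop_zero (hφs.continuous_iteratedDeriv j (by exact_mod_cast le_top)) ?_
      hσ.tendsto_zero
    have := hφc.iteratedFDeriv (𝕜 := ℝ) j
    rw [iteratedDeriv_eq_equiv_comp]
    exact this.comp_left (by simp)) (funext hcon)
  have h1 := φ.dist_normed_convolution_le (μ := volume) (g := σ) (x₀ := x₀) (ε := |σ x₀| / 2)
    hcont.aestronglyMeasurable (fun x hx => (hδ' x hx).le)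
  rw [hcomm, h0] at h1
  simp only [Pi.zero_apply, dist_zero_left, Real.norm_eq_abs] at h1
  have : 0 < |σ x₀| := abs_pos.2 hx₀
  linarith

end Decay

/-! ### Uniform density of networks -/

section CompactSpace

variable {X : Type*} [TopologicalSpace X] [CompactSpace X]

theorem Submodule.mem_of_hasDerivAt {V : Type*} [NormedAddCommGroup V] [NormedSpace ℝ V]
    {S : Submodule ℝ V} (hS : IsClosed (S : Set V)) {F : ℝ → V} {F' : V} {t : ℝ}
    (hF : ∀ s, F s ∈ S) (h : HasDerivAt F F' t) : F' ∈ S := by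
  rw [hasDerivAt_iff_tendsto_slope] at h
  refine hS.mem_of_tendsto h (Eventually.of_forall fun s => ?_)
  rw [slope_def_module]
  exact S.smul_mem _ (S.sub_mem (hF s) (hF t))

/-- For `g ∈ C¹(ℝ)`, the curve `h ↦ g ∘ (h a + b)` in `C(X, ℝ)` is differentiable for the
uniform norm. -/
theorem ContinuousMap.hasDerivAt_comp_smul_add_const {g g' : C(ℝ, ℝ)}
    (hg : ∀ s, HasDerivAt g (g' s) s) (a : C(X, ℝ)) (b h : ℝ) :
    HasDerivAt (fun h : ℝ => g.comp (h • a + const X b)) (a * g'.comp (h • a + const X b)) h := by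
  let G : ℝ → C(X, ℝ) := fun h => a * g'.comp (h • a + const X b)
  have hG : Continuous G := by
    refine continuous_const.mul ((ContinuousMap.continuous_postcomp g').comp ?_)
    exact (continuous_id.smul continuous_const).add continuous_const
  have hFTC : ∀ h : ℝ, g.comp (h • a + const X b) = g.comp (const X b) + ∫ s in (0 : ℝ)..h, G s := by
    intro h
    ext x
    have h1 := (ContinuousMap.evalCLM ℝ x).intervalIntegral_comp_comm (hG.intervalIntegrable (μ := volume) 0 h)
    rw [ContinuousMap.add_apply]
    have h2 : ∫ s in (0 : ℝ)..h, ContinuousMap.evalCLM ℝ x (G s) = g (h * a x + b) - g (0 * a x + b) := by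
      have h5 : ∀ s, HasDerivAt (fun s : ℝ => g (s * a x + b)) (ContinuousMap.evalCLM ℝ x (G s)) s := by
        intro s
        have h3 : HasDerivAt (fun s : ℝ => s * a x + b) (a x) s := by
          simpa using ((hasDerivAt_id s).mul_const (a x)).add_const b
        have h4 := (hg (s * a x + b)).comp s h3
        rw [mul_comm] at h4
        exact h4
      exact intervalIntegral.integral_eq_sub_of_hasDerivAt (fun s _ => h5 s)
        (((ContinuousMap.evalCLM ℝ x).continuous.comp hG).intervalIntegrable 0 h)
    rw [h1] at h2
    change _ = _ + (∫ s in (0 : ℝ)..h, G s) x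
    change (∫ s in (0 : ℝ)..h, G s) x = _ at h2
    rw [h2]
    simp
  have hd : HasDerivAt (fun h : ℝ => g.comp (const X b) + ∫ s in (0 : ℝ)..h, G s) (G h) h :=
    (intervalIntegral.integral_hasDerivAt_right (hG.intervalIntegrable 0 h)
      (hG.stronglyMeasurableAtFilter _ _) hG.continuousAt).const_add _
  rwa [← funext hFTC] at hd

/-- A closed subspace of `C(X, ℝ)` containing all `σ ∘ (h a + b)` contains `exp a`. After replacing
`σ` by a mollification `f`, repeated differentiation in `h` at `h = 0` yields `f⁽ᵏ⁾(b) aᵏ`, and `b`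
may be chosen with `f⁽ᵏ⁾(b) ≠ 0`. -/
theorem IsSobolevSmooth.exp_mem {σ : ℝ → ℝ} (hσ : IsSobolevSmooth 1 2 σ) (hσ0 : σ ≠ 0)
    {S : Submodule ℝ C(X, ℝ)} (hS : IsClosed (S : Set C(X, ℝ))) (a : C(X, ℝ))
    (hmem : ∀ h b : ℝ, (⟨σ, hσ.contDiff.continuous⟩ : C(ℝ, ℝ)).comp
      (h • a + ContinuousMap.const X b) ∈ S) : NormedSpace.exp a ∈ S := by
  obtain ⟨φ, hφ, hφc, hf, hne⟩ := hσ.exists_mollification hσ0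
  set f := convolution φ σ (lsmul ℝ ℝ) volume with hfdef
  let g : ℕ → C(ℝ, ℝ) := fun k => ⟨iteratedDeriv k f,
    hf.continuous_iteratedDeriv k (by exact_mod_cast le_top)⟩
  have hg : ∀ k s, HasDerivAt (g k) (g (k + 1) s) s := by
    intro k s
    change HasDerivAt (iteratedDeriv k f) (iteratedDeriv (k + 1) f s) s
    rw [iteratedDeriv_succ]
    exact ((hf.differentiable_iteratedDeriv k (by exact_mod_cast ENat.natCast_lt_top k)) s).hasDerivAt
  have hmoll : ∀ h b : ℝ, (g 0).comp (h • a + ContinuousMap.const X b) ∈ S := by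
    intro h b
    let F : ℝ → C(X, ℝ) := fun t => φ t • (⟨σ, hσ.contDiff.continuous⟩ : C(ℝ, ℝ)).comp
      (h • a + ContinuousMap.const X (b - t))
    have hF : Continuous F := by
      refine hφ.smul ((ContinuousMap.continuous_postcomp _).comp ?_)
      exact continuous_const.add (ContinuousMap.continuous_const'.comp (continuous_const.sub continuous_id))
    have hFi : Integrable F := hF.integrable_of_hasCompactSupport hφc.smul_right
    have : (g 0).comp (h • a + ContinuousMap.const X b) = ∫ t, F t := by
      ext x
      rw [ContinuousMap.integral_apply hFi]
      simp [g, F, hfdef, convolution_def, add_sub_assoc]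
    rw [this]
    exact S.integral_mem_of_isClosed hS fun t => S.smul_mem _ (hmem h _)
  have hder : ∀ k, ∀ h b : ℝ, a ^ k * (g k).comp (h • a + ContinuousMap.const X b) ∈ S := by
    intro k
    induction k with
    | zero => simpa using hmoll
    | succ k ih =>
      intro h b
      refine Submodule.mem_of_hasDerivAt hS (fun s => ih s b) (t := h) ?_
      have := (ContinuousMap.hasDerivAt_comp_smul_add_const (hg k) a b h).const_mul (a ^ k)
      rwa [← mul_assoc, ← pow_succ] at this
  have hpow : ∀ k, a ^ k ∈ S := by
    intro k
    obtain ⟨b, hb⟩ := hne k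
    have h1 := S.smul_mem (iteratedDeriv k f b)⁻¹ (hder k 0 b)
    convert h1 using 1
    ext x
    simp [g]
    field_simp
  have hsum := NormedSpace.exp_series_hasSum_exp' (𝕂 := ℝ) a
  exact hS.mem_of_tendsto hsum (Eventually.of_forall fun s =>
    S.sum_mem fun k _ => S.smul_mem _ (hpow k))

end CompactSpace

section RidgeSpan

variable {E : Type*} [NormedAddCommGroup E] [InnerProductSpace ℝ E]

/-- The space of all functions on `E` computed by one-hidden-layer networks with activation
function `σ`, as the linear span of the ridge functions `u ↦ σ (⟪w, u⟫ + b)`. -/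
def ridgeSpan (E : Type*) [NormedAddCommGroup E] [InnerProductSpace ℝ E] (σ : ℝ → ℝ) :
    Submodule ℝ (E → ℝ) :=
  Submodule.span ℝ (Set.range fun (p : E × ℝ) (u : E) => σ (inner ℝ p.1 u + p.2))

/-- Density of `ridgeSpan` in `C(B, ℝ)`: the closure contains the exponentials `u ↦ exp ⟪w, u⟫`,
whose span is an algebra separating points, so the Stone–Weierstrass theorem applies. -/
theorem IsSobolevSmooth.exists_mem_ridgeSpan_abs_sub_lt {σ : ℝ → ℝ} (hσ : IsSobolevSmooth 1 2 σ)
    (hσ0 : σ ≠ 0) {B : Set E} (hB : IsCompact B) {g : E → ℝ} (hg : ContinuousOn g B) {ε : ℝ}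
    (hε : 0 < ε) : ∃ p ∈ ridgeSpan E σ, ∀ x ∈ B, |p x - g x| < ε := by
  have : CompactSpace B := isCompact_iff_compactSpace.1 hB
  let S₀ : Submodule ℝ C(B, ℝ) := ((ridgeSpan E σ).map
    (LinearMap.funLeft ℝ ℝ (Subtype.val : B → E))).comap (ContinuousMap.coeFnLinearMap ℝ)
  let S := S₀.topologicalClosure
  have hS : IsClosed (S : Set C(B, ℝ)) := S₀.isClosed_topologicalClosure
  let a : E → C(B, ℝ) := fun w => ⟨fun x => inner ℝ w x.1, by fun_prop⟩
  have hexp : ∀ w, NormedSpace.exp (a w) ∈ S := by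
    intro w
    refine hσ.exp_mem hσ0 hS (a w) fun h b => S₀.le_topologicalClosure ?_
    refine ⟨fun u => σ (inner ℝ (h • w) u + b), Submodule.subset_span ⟨(h • w, b), rfl⟩, ?_⟩
    ext x
    simp [a, LinearMap.funLeft, inner_smul_left]
  let A : Subalgebra ℝ C(B, ℝ) := Algebra.adjoin ℝ (Set.range fun w => NormedSpace.exp (a w))
  have hAS : Subalgebra.toSubmodule A ≤ S := by
    rw [Algebra.adjoin_eq_span, Submodule.span_le]
    intro c hc
    have : ∃ w, NormedSpace.exp (a w) = c := by
      induction hc using Submonoid.closure_induction with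
      | mem x hx => exact hx
      | one =>
        refine ⟨0, ?_⟩
        have : a 0 = 0 := by ext x; simp [a]
        rw [this, NormedSpace.exp_zero]
      | mul x y _ _ hx hy =>
        obtain ⟨w, rfl⟩ := hx
        obtain ⟨w', rfl⟩ := hy
        refine ⟨w + w', ?_⟩
        have : a (w + w') = a w + a w' := by ext x; simp [a, inner_add_left]
        rw [this, NormedSpace.exp_add]
    obtain ⟨w, rfl⟩ := this
    exact hexp w
  have hexpv : ∀ w x, (NormedSpace.exp (a w)) x = Real.exp (inner ℝ w x.1) := by
    intro w x
    have := NormedSpace.map_exp (ContinuousMap.evalAlgHom ℝ ℝ x) (ContinuousMap.evalCLM ℝ x).continuous (a w)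
    rw [Real.exp_eq_exp_ℝ]
    exact this
  have hsep : A.SeparatesPoints := by
    intro x y hxy
    refine ⟨_, ⟨NormedSpace.exp (a (x.1 - y.1)), Algebra.subset_adjoin ⟨_, rfl⟩, rfl⟩, ?_⟩
    intro h
    beta_reduce at h
    rw [hexpv, hexpv] at h
    have h1 := Real.exp_injective h
    rw [← sub_eq_zero, ← inner_sub_right, inner_self_eq_zero, sub_eq_zero] at h1
    exact hxy (Subtype.ext h1)
  have htop := ContinuousMap.subalgebra_topologicalClosure_eq_top_of_separatesPoints A hsep
  let c : C(B, ℝ) := ⟨B.domRestrict g, hg.domRestrict⟩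
  have hc : c ∈ closure (S₀ : Set C(B, ℝ)) := by
    have h1 : c ∈ A.topologicalClosure := htop ▸ Algebra.mem_top
    have h2 : c ∈ closure (A : Set C(B, ℝ)) := h1
    exact closure_minimal (fun x hx => hAS hx) hS h2
  obtain ⟨d, ⟨p, hp, hpd⟩, hd⟩ := Metric.mem_closure_iff.1 hc ε hε
  refine ⟨p, hp, fun x hx => ?_⟩
  have h1 := (ContinuousMap.dist_lt_iff hε).1 hd ⟨x, hx⟩
  have h2 : p x = d ⟨x, hx⟩ := congrFun hpd ⟨x, hx⟩
  rw [dist_comm, Real.dist_eq] at h1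
  rw [h2]
  exact h1

end RidgeSpan

/-! ### Density of networks for `Cᵐ`-convergence -/

section RidgeSpan

variable {E : Type*} [NormedAddCommGroup E] [InnerProductSpace ℝ E]

theorem contDiff_of_mem_ridgeSpan {σ : ℝ → ℝ} {n : WithTop ℕ∞} (hσ : ContDiff ℝ n σ) {p : E → ℝ}
    (hp : p ∈ ridgeSpan E σ) : ContDiff ℝ n p := by
  induction hp using Submodule.span_induction with
  | mem p hp =>
    obtain ⟨⟨w, b⟩, rfl⟩ := hp
    exact hσ.comp ((contDiff_const.inner ℝ contDiff_id).add contDiff_const)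
  | zero => exact contDiff_const
  | add p q _ _ hp hq => exact hp.add hq
  | smul c p _ hp => exact contDiff_const.smul hp

theorem comp_sub_mem_ridgeSpan {σ : ℝ → ℝ} {p : E → ℝ} (hp : p ∈ ridgeSpan E σ) (y : E) :
    (fun x => p (x - y)) ∈ ridgeSpan E σ := by
  induction hp using Submodule.span_induction with
  | mem p hp =>
    obtain ⟨⟨w, b⟩, rfl⟩ := hp
    refine Submodule.subset_span ⟨(w, b - inner ℝ w y), ?_⟩
    ext x
    simp only [inner_sub_right]
    congr 1
    ring
  | zero => exact (ridgeSpan E σ).zero_mem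
  | add p q _ _ hp hq => exact (ridgeSpan E σ).add_mem hp hq
  | smul c p _ hp => exact (ridgeSpan E σ).smul_mem c hp

theorem exists_toFun_eq_of_mem_ridgeSpan {N : ℕ} {σ : ℝ → ℝ} {p : EuclideanSpace ℝ (Fin N) → ℝ}
    (hp : p ∈ ridgeSpan (EuclideanSpace ℝ (Fin N)) σ) :
    ∃ net : NeuralNetwork N, net.toFun σ = p := by
  obtain ⟨r, c, g, rfl⟩ := Submodule.mem_span_set'.1 hp
  choose w hw using fun i => (g i).2
  refine ⟨⟨r, fun i => (w i).1, fun i => (w i).2, c⟩, ?_⟩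
  ext u
  simp only [NeuralNetwork.toFun, Finset.sum_apply, Pi.smul_apply, smul_eq_mul]
  refine Finset.sum_congr rfl fun i _ => ?_
  rw [← hw i]

variable [FiniteDimensional ℝ E] [MeasurableSpace E] [BorelSpace E] {μ : Measure E}
  [μ.IsAddHaarMeasure]

set_option maxSynthPendingDepth 3 in
/-- An average of translates `x ↦ p (x - y)` of a network is a `Cᵐ`-limit of networks on a
compact set: its `m`-jet is a Bochner integral in the Banach space of continuous `m`-jets on `K`, and
the integrand takes its values in the jets of networks. -/
theorem exists_mem_ridgeSpan_iteratedFDeriv_convolution {σ : ℝ → ℝ} {m : ℕ} (hσ : ContDiff ℝ m σ)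
    {f : E → ℝ} (hf : Continuous f) (hfc : HasCompactSupport f) {p : E → ℝ}
    (hp : p ∈ ridgeSpan E σ) {K : Set E} (hK : IsCompact K) {ε : ℝ} (hε : 0 < ε) :
    ∃ q ∈ ridgeSpan E σ, ∀ k ≤ m, ∀ x ∈ K,
      ‖iteratedFDeriv ℝ k (convolution f p (lsmul ℝ ℝ) μ) x - iteratedFDeriv ℝ k q x‖ < ε := by
  have : CompactSpace K := isCompact_iff_compactSpace.1 hK
  have hpm : ContDiff ℝ m p := contDiff_of_mem_ridgeSpan hσ hp
  have hpk : ∀ k : Fin (m + 1), Continuous (iteratedFDeriv ℝ (k : ℕ) p) := fun k =>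
    hpm.continuous_iteratedFDeriv (by exact_mod_cast (by omega : (k : ℕ) ≤ m))
  let V := (k : Fin (m + 1)) → C(K, E [×(k : ℕ)]→L[ℝ] ℝ)
  let S₀ : Submodule ℝ V :=
    { carrier := {v | ∃ q ∈ ridgeSpan E σ, ∀ k x, v k x = iteratedFDeriv ℝ (k : ℕ) q x.1}
      zero_mem' := ⟨0, (ridgeSpan E σ).zero_mem, fun k x => by simp; rfl⟩
      add_mem' := by
        rintro v v' ⟨q, hq, hv⟩ ⟨q', hq', hv'⟩
        refine ⟨q + q', (ridgeSpan E σ).add_mem hq hq', fun k x => ?_⟩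
        have hk : ((k : ℕ) : WithTop ℕ∞) ≤ m := by exact_mod_cast (by omega : (k : ℕ) ≤ m)
        rw [iteratedFDeriv_add_apply ((contDiff_of_mem_ridgeSpan hσ hq).of_le hk).contDiffAt
          ((contDiff_of_mem_ridgeSpan hσ hq').of_le hk).contDiffAt, ← hv, ← hv']
        rfl
      smul_mem' := by
        rintro c v ⟨q, hq, hv⟩
        refine ⟨c • q, (ridgeSpan E σ).smul_mem c hq, fun k x => ?_⟩
        have hk : ((k : ℕ) : WithTop ℕ∞) ≤ m := by exact_mod_cast (by omega : (k : ℕ) ≤ m)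
        rw [iteratedFDeriv_const_smul_apply
          ((contDiff_of_mem_ridgeSpan hσ hq).of_le hk).contDiffAt, ← hv]
        rfl }
  let J : (k : Fin (m + 1)) → C(E, C(K, E [×(k : ℕ)]→L[ℝ] ℝ)) := fun k =>
    ContinuousMap.curry ⟨fun z : E × K => iteratedFDeriv ℝ (k : ℕ) p (z.2.1 - z.1),
      (hpk k).comp (by fun_prop)⟩
  let F : E → V := fun y => f y • fun k => J k y
  have hF : Continuous F := hf.smul (continuous_pi fun k => (J k).continuous)
  have hFi : Integrable F μ := hF.integrable_of_hasCompactSupport hfc.smul_right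
  have hFS : ∀ y, F y ∈ S₀.topologicalClosure := by
    intro y
    refine S₀.le_topologicalClosure (S₀.smul_mem _ ⟨_, comp_sub_mem_ridgeSpan hp y, fun k x => ?_⟩)
    rw [iteratedFDeriv_comp_sub]
    rfl
  have hmem : ∫ y, F y ∂μ ∈ S₀.topologicalClosure :=
    Submodule.integral_mem_of_isClosed _ S₀.isClosed_topologicalClosure hFS
  have heval : ∀ k x, (∫ y, F y ∂μ) k x =
      iteratedFDeriv ℝ (k : ℕ) (convolution f p (lsmul ℝ ℝ) μ) x.1 := by
    intro k x
    rw [iteratedFDeriv_convolution_lsmul hf.locallyIntegrable (Or.inl hfc) hpm (by omega)]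
    have h1 := (ContinuousLinearMap.proj (R := ℝ)
      (φ := fun k : Fin (m + 1) => C(K, E [×(k : ℕ)]→L[ℝ] ℝ)) k).integral_comp_comm hFi
    have h2 : (∫ y, F y ∂μ) k = ∫ y, F y k ∂μ := h1.symm
    have h3 : Integrable (fun y => F y k) μ := (ContinuousLinearMap.proj (R := ℝ)
      (φ := fun k : Fin (m + 1) => C(K, E [×(k : ℕ)]→L[ℝ] ℝ)) k).integrable_comp hFi
    rw [h2, ContinuousMap.integral_apply h3]
    rfl
  obtain ⟨v, ⟨q, hq, hv⟩, hd⟩ := Metric.mem_closure_iff.1 hmem ε hε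
  refine ⟨q, hq, fun k hk x hx => ?_⟩
  have h1 := heval ⟨k, by omega⟩ ⟨x, hx⟩
  have h2 := hv ⟨k, by omega⟩ ⟨x, hx⟩
  rw [← dist_eq_norm]
  simp only at h1 h2
  rw [← h1, ← h2]
  exact (ContinuousMap.dist_apply_le_dist _).trans_lt ((dist_le_pi_dist _ _ _).trans_lt hd)

set_option maxSynthPendingDepth 3 in
/-- Networks are dense in `C^∞(E)` for `Cᵐ`-convergence on compact sets. A cut-off `f` of `H` is
`Cᵐ`-close to `Φ ⋆ f` for an approximate identity `Φ`. The derivatives fall on `f`, so `Φ` may be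
replaced by a network `p` that is only uniformly close to it on a ball; finally `p ⋆ f = f ⋆ p` is an
average of translates of `p`. -/
theorem IsSobolevSmooth.exists_mem_ridgeSpan_iteratedFDeriv {σ : ℝ → ℝ}
    (hσ : IsSobolevSmooth 1 2 σ) (hσ0 : σ ≠ 0) {m : ℕ} (hσm : ContDiff ℝ m σ) {H : E → ℝ}
    (hH : ContDiff ℝ ∞ H) {K : Set E} (hK : IsCompact K) {ε : ℝ} (hε : 0 < ε) :
    ∃ q ∈ ridgeSpan E σ, ∀ k ≤ m, ∀ x ∈ K,
      ‖iteratedFDeriv ℝ k H x - iteratedFDeriv ℝ k q x‖ < ε := by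
  let μ : Measure E := Measure.addHaar
  obtain ⟨R, hR0, hR⟩ := hK.isBounded.subset_closedBall_lt 0 (0 : E)
  let χ : ContDiffBump (0 : E) := ⟨R + 1, R + 2, by linarith, by linarith⟩
  let f : E → ℝ := fun x => χ x • H x
  have hfs : ContDiff ℝ ∞ f := χ.contDiff.smul hH
  have hfc : HasCompactSupport f := χ.hasCompactSupport.smul_right
  have hfK : ∀ k, ∀ x ∈ K, iteratedFDeriv ℝ k f x = iteratedFDeriv ℝ k H x := by
    intro k x hx
    refine (Filter.EventuallyEq.iteratedFDeriv ℝ ?_ k).eq_of_nhds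
    have hx' : x ∈ ball (0 : E) (R + 1) := by
      have := hR hx
      rw [mem_closedBall] at this
      rw [mem_ball]
      linarith
    filter_upwards [isOpen_ball.mem_nhds hx'] with z hz
    simp [f, χ.one_of_mem_closedBall (ball_subset_closedBall hz)]
  have hkc : ∀ k : ℕ, Continuous (iteratedFDeriv ℝ k f) := fun k =>
    hfs.continuous_iteratedFDeriv (by exact_mod_cast le_top)
  have hkcs : ∀ k : ℕ, HasCompactSupport (iteratedFDeriv ℝ k f) := fun k => hfc.iteratedFDeriv k
  obtain ⟨δ, hδ, hδ0⟩ : ∃ δ : ℝ, (∀ k ∈ Finset.range (m + 1), ∀ x z : E, dist x z < δ →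
      dist (iteratedFDeriv ℝ k f x) (iteratedFDeriv ℝ k f z) ≤ ε / 4) ∧ 0 < δ := by
    have h1 : ∀ᶠ δ in 𝓝[>] (0 : ℝ), ∀ k ∈ Finset.range (m + 1), ∀ x z : E, dist x z < δ →
        dist (iteratedFDeriv ℝ k f x) (iteratedFDeriv ℝ k f z) ≤ ε / 4 := by
      rw [Filter.eventually_all_finset]
      intro k _
      obtain ⟨δ, hδ0, hδ⟩ := Metric.uniformContinuous_iff.1
        ((hkcs k).uniformContinuous_of_continuous (hkc k)) (ε / 4) (by positivity)
      filter_upwards [Ioo_mem_nhdsGT hδ0] with δ' hδ' x z hxz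
      exact (hδ (hxz.trans hδ'.2)).le
    exact (h1.and self_mem_nhdsWithin).exists
  let φ : ContDiffBump (0 : E) := ⟨δ / 2, δ, by linarith, by linarith⟩
  let I : ℝ := ∑ k ∈ Finset.range (m + 1), ∫ t, ‖iteratedFDeriv ℝ k f t‖ ∂μ
  have hI0 : ∀ k, 0 ≤ ∫ t, ‖iteratedFDeriv ℝ k f t‖ ∂μ := fun k =>
    integral_nonneg fun t => norm_nonneg _
  have hI : 0 ≤ I := Finset.sum_nonneg fun k _ => hI0 k
  obtain ⟨p, hp, hpφ⟩ := hσ.exists_mem_ridgeSpan_abs_sub_lt hσ0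
    (isCompact_closedBall (0 : E) (R + (R + 2))) (g := φ.normed μ)
    φ.continuous_normed.continuousOn (ε := ε / 4 / (I + 1)) (by positivity)
  have hpcont : Continuous p := (contDiff_of_mem_ridgeSpan hσm hp).continuous
  obtain ⟨q, hq, hqe⟩ := exists_mem_ridgeSpan_iteratedFDeriv_convolution (μ := μ) hσm hfs.continuous
    hfc hp hK (ε := ε / 4) (by positivity)
  refine ⟨q, hq, fun k hk x hx => ?_⟩
  have hkr : k ∈ Finset.range (m + 1) := Finset.mem_range.2 (by omega)
  have hcomm : convolution f p (lsmul ℝ ℝ) μ = convolution p f (lsmul ℝ ℝ) μ := by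
    ext x
    rw [convolution_lsmul_swap]
    simp [convolution_def, mul_comm]
  have e1 := hqe k hk x hx
  rw [hcomm, iteratedFDeriv_convolution_lsmul (m := k) hpcont.locallyIntegrable (Or.inr hfc)
    (hfs.of_le (by exact_mod_cast le_top)) le_rfl] at e1
  have e2 := φ.dist_normed_convolution_le (μ := μ) (g := iteratedFDeriv ℝ k f) (x₀ := x)
    (ε := ε / 4) (hkc k).aestronglyMeasurable (fun z hz => hδ k hkr z x hz)
  have e3 : ‖convolution (φ.normed μ) (iteratedFDeriv ℝ k f) (lsmul ℝ ℝ) μ x -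
      convolution p (iteratedFDeriv ℝ k f) (lsmul ℝ ℝ) μ x‖ ≤ ε / 4 := by
    have hi : ∀ g : E → ℝ, Continuous g →
        Integrable (fun t => g (x - t) • iteratedFDeriv ℝ k f t) μ := fun g hg =>
      ((hg.comp (continuous_const.sub continuous_id)).smul (hkc k)).integrable_of_hasCompactSupport
        (hkcs k).smul_left
    rw [convolution_lsmul_swap, convolution_lsmul_swap,
      ← integral_sub (hi _ φ.continuous_normed) (hi _ hpcont)]
    have hb : ∀ t, ‖φ.normed μ (x - t) • iteratedFDeriv ℝ k f t - p (x - t) • iteratedFDeriv ℝ k f t‖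
        ≤ ε / 4 / (I + 1) * ‖iteratedFDeriv ℝ k f t‖ := by
      intro t
      rw [← sub_smul, norm_smul]
      by_cases ht : iteratedFDeriv ℝ k f t = 0
      · simp [ht]
      · have h1 : t ∈ tsupport f := support_iteratedFDeriv_subset k ht
        have h2 : t ∈ closedBall (0 : E) (R + 2) :=
          χ.tsupport_eq ▸ (closure_mono (Function.support_smul_subset_left _ _)) h1
        have h3 := hR hx
        rw [mem_closedBall, dist_zero_right] at h2 h3
        have h4 := hpφ (x - t) (by
          rw [mem_closedBall, dist_zero_right]
          exact (norm_sub_le _ _).trans (add_le_add h3 h2))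
        rw [Real.norm_eq_abs, abs_sub_comm]
        gcongr
    calc _ ≤ ∫ t, ε / 4 / (I + 1) * ‖iteratedFDeriv ℝ k f t‖ ∂μ :=
          norm_integral_le_of_norm_le
            (((hkc k).integrable_of_hasCompactSupport (hkcs k)).norm.const_mul _)
            (Eventually.of_forall hb)
      _ = ε / 4 / (I + 1) * ∫ t, ‖iteratedFDeriv ℝ k f t‖ ∂μ := integral_const_mul _ _
      _ ≤ ε / 4 / (I + 1) * (I + 1) := by
          gcongr
          have := Finset.single_le_sum (fun k _ => hI0 k) hkr
          linarith
      _ = ε / 4 := by field_simp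
  rw [← hfK k x hx]
  rw [dist_eq_norm] at e2
  have e4 : iteratedFDeriv ℝ k f x - iteratedFDeriv ℝ k q x =
      -(convolution (φ.normed μ) (iteratedFDeriv ℝ k f) (lsmul ℝ ℝ) μ x - iteratedFDeriv ℝ k f x) +
      (convolution (φ.normed μ) (iteratedFDeriv ℝ k f) (lsmul ℝ ℝ) μ x -
        convolution p (iteratedFDeriv ℝ k f) (lsmul ℝ ℝ) μ x) +
      (convolution p (iteratedFDeriv ℝ k f) (lsmul ℝ ℝ) μ x - iteratedFDeriv ℝ k q x) := by abel
  rw [e4]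
  refine (norm_add₃_le).trans_lt ?_
  rw [norm_neg]
  linarith

end RidgeSpan

/-! ### Envelopes with bounded slope along the kernel of a linear map -/

section ConeCost

variable {E F : Type*} [NormedAddCommGroup E] [NormedSpace ℝ E] [NormedAddCommGroup F]
  [NormedSpace ℝ F]

/-- The cost `L ‖z‖ + ‖Q z‖ / δ` of a displacement `z`. As `δ → 0` displacements outside `ker Q`
become infinitely expensive, while those in `ker Q` cost `L` per unit of length. -/
noncomputable def coneCost (Q : E →L[ℝ] F) (L δ : ℝ) (z : E) : ℝ := L * ‖z‖ + δ⁻¹ * ‖Q z‖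

variable {Q : E →L[ℝ] F} {L δ : ℝ}

theorem coneCost_neg (z : E) : coneCost Q L δ (-z) = coneCost Q L δ z := by simp [coneCost]

theorem coneCost_sub_comm (x y : E) : coneCost Q L δ (x - y) = coneCost Q L δ (y - x) := by
  rw [← coneCost_neg, neg_sub]

theorem coneCost_zero : coneCost Q L δ 0 = 0 := by simp [coneCost]

theorem coneCost_of_ker {z : E} (hz : Q z = 0) : coneCost Q L δ z = L * ‖z‖ := by
  simp [coneCost, hz]

theorem coneCost_add_le (hL : 0 ≤ L) (hδ : 0 ≤ δ) (z w : E) :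
    coneCost Q L δ (z + w) ≤ coneCost Q L δ z + coneCost Q L δ w := by
  have h1 := mul_le_mul_of_nonneg_left (norm_add_le z w) hL
  have h2 := mul_le_mul_of_nonneg_left (norm_add_le (Q z) (Q w)) (inv_nonneg.2 hδ)
  simp only [coneCost, map_add]
  linarith

theorem coneCost_le (hδ : 0 ≤ δ) (z : E) :
    coneCost Q L δ z ≤ (L + δ⁻¹ * ‖Q‖) * ‖z‖ := by
  have h2 := mul_le_mul_of_nonneg_left (Q.le_opNorm z) (inv_nonneg.2 hδ)
  simp only [coneCost]
  linarith

theorem coneCost_anti (hδ : 0 < δ) {δ' : ℝ} (h : δ ≤ δ') (z : E) :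
    coneCost Q L δ' z ≤ coneCost Q L δ z := by
  simp only [coneCost]
  gcongr

theorem norm_mul_le_coneCost (hδ : 0 ≤ δ) (z : E) : L * ‖z‖ ≤ coneCost Q L δ z :=
  le_add_of_nonneg_right (by positivity)

/-- The functions that lie below `H` on `K` and whose increments over distances less than `δ`, in
the `δ`-neighbourhood of `K`, are bounded by `coneCost`. -/
def coneMinorants (Q : E →L[ℝ] F) (L δ : ℝ) (K : Set E) (H : E → ℝ) : Set (E → ℝ) :=
  {g | (∀ x ∈ K, g x ≤ H x) ∧ ∀ x ∈ thickening δ K, ∀ y ∈ thickening δ K, dist x y < δ →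
    g x ≤ g y + coneCost Q L δ (x - y)}

/-- The largest element of `coneMinorants`; its values are meaningful on the `δ`-neighbourhood
of `K` only. -/
noncomputable def coneEnvelope (Q : E →L[ℝ] F) (L δ : ℝ) (K : Set E) (H : E → ℝ) (x : E) : ℝ :=
  ⨆ g : coneMinorants Q L δ K H, g.1 x

variable {K : Set E} {H : E → ℝ} {M : ℝ}

theorem const_mem_coneMinorants (hL : 0 ≤ L) (hδ : 0 ≤ δ) (hM : ∀ x ∈ K, |H x| ≤ M) :
    (fun _ => -M) ∈ coneMinorants Q L δ K H := by
  refine ⟨fun x hx => (abs_le.1 (hM x hx)).1, fun x _ y _ _ => le_add_of_nonneg_right ?_⟩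
  unfold coneCost
  positivity

theorem bddAbove_coneMinorants (hL : 0 ≤ L) (hδ : 0 ≤ δ) (hM : ∀ x ∈ K, |H x| ≤ M) {x : E}
    (hx : x ∈ thickening δ K) :
    BddAbove (Set.range fun g : coneMinorants Q L δ K H => g.1 x) := by
  obtain ⟨z, hz, hxz⟩ := mem_thickening_iff.1 hx
  have hδ' : 0 < δ := dist_nonneg.trans_lt hxz
  refine ⟨M + (L + δ⁻¹ * ‖Q‖) * δ, ?_⟩
  rintro _ ⟨⟨g, hg⟩, rfl⟩
  have h1 := hg.2 x hx z (self_subset_thickening hδ' K hz) hxz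
  have h2 := hg.1 z hz
  have h3 := (abs_le.1 (hM z hz)).2
  have h4 : coneCost Q L δ (x - z) ≤ (L + δ⁻¹ * ‖Q‖) * δ := by
    refine (coneCost_le hδ _).trans ?_
    rw [← dist_eq_norm]
    gcongr
  simp only
  linarith

theorem le_coneEnvelope (hL : 0 ≤ L) (hδ : 0 ≤ δ) (hM : ∀ x ∈ K, |H x| ≤ M) {g : E → ℝ}
    (hg : g ∈ coneMinorants Q L δ K H) {x : E} (hx : x ∈ thickening δ K) :
    g x ≤ coneEnvelope Q L δ K H x :=
  le_ciSup (bddAbove_coneMinorants hL hδ hM hx) (⟨g, hg⟩ : coneMinorants Q L δ K H)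

theorem coneEnvelope_mem (hL : 0 ≤ L) (hδ : 0 ≤ δ) (hM : ∀ x ∈ K, |H x| ≤ M) :
    coneEnvelope Q L δ K H ∈ coneMinorants Q L δ K H := by
  have : Nonempty (coneMinorants Q L δ K H) := ⟨⟨_, const_mem_coneMinorants hL hδ hM⟩⟩
  refine ⟨fun x hx => ciSup_le fun g => g.2.1 x hx, fun x hx y hy hxy => ciSup_le fun g => ?_⟩
  exact (g.2.2 x hx y hy hxy).trans (by gcongr; exact le_coneEnvelope hL hδ hM g.2 hy)

theorem coneEnvelope_mono (hL : 0 ≤ L) (hδ : 0 < δ) {δ' : ℝ} (h : δ ≤ δ')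
    (hM : ∀ x ∈ K, |H x| ≤ M) {x : E} (hx : x ∈ thickening δ K) :
    coneEnvelope Q L δ' K H x ≤ coneEnvelope Q L δ K H x := by
  have hm := coneEnvelope_mem (Q := Q) hL (hδ.le.trans h) hM
  refine le_coneEnvelope hL hδ.le hM ⟨hm.1, fun x hx y hy hxy => ?_⟩ hx
  exact (hm.2 x (thickening_mono h K hx) y (thickening_mono h K hy) (hxy.trans_le h)).trans
    (by gcongr; exact coneCost_anti hδ h _)

theorem abs_sub_le_coneCost {g : E → ℝ} {x y : E}
    (hg : ∀ x ∈ thickening δ K, ∀ y ∈ thickening δ K, dist x y < δ →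
      g x ≤ g y + coneCost Q L δ (x - y))
    (hx : x ∈ thickening δ K) (hy : y ∈ thickening δ K) (hxy : dist x y < δ) :
    |g x - g y| ≤ coneCost Q L δ (x - y) := by
  have h1 := hg x hx y hy hxy
  have h2 := hg y hy x hx (by rwa [dist_comm])
  rw [coneCost_sub_comm] at h2
  rw [abs_le]
  constructor <;> linarith

theorem continuousOn_of_coneCost (hL : 0 ≤ L) (hδ : 0 < δ) {g : E → ℝ}
    (hg : ∀ x ∈ thickening δ K, ∀ y ∈ thickening δ K, dist x y < δ →
      g x ≤ g y + coneCost Q L δ (x - y)) : ContinuousOn g (thickening δ K) := by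
  rw [Metric.continuousOn_iff]
  intro x hx ε hε
  have hC : 0 < L + δ⁻¹ * ‖Q‖ + 1 := by positivity
  refine ⟨min δ (ε / (L + δ⁻¹ * ‖Q‖ + 1)), by positivity, fun y hy hyx => ?_⟩
  obtain ⟨h1, h2⟩ := lt_min_iff.1 hyx
  rw [Real.dist_eq]
  calc |g y - g x| ≤ coneCost Q L δ (y - x) := abs_sub_le_coneCost hg hy hx h1
    _ ≤ (L + δ⁻¹ * ‖Q‖) * ‖y - x‖ := coneCost_le hδ.le _
    _ ≤ (L + δ⁻¹ * ‖Q‖ + 1) * ‖y - x‖ :=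
        mul_le_mul_of_nonneg_right (by linarith) (norm_nonneg _)
    _ < (L + δ⁻¹ * ‖Q‖ + 1) * (ε / (L + δ⁻¹ * ‖Q‖ + 1)) := by
        rw [dist_eq_norm] at h2
        gcongr
    _ = ε := by field_simp

/-- If there is room above the envelope around `x₀`, then the envelope decreases away from `x₀`
almost at the full rate, up to distance `r`: otherwise its maximum with the cone
`x ↦ coneEnvelope x₀ + η - coneCost (x - x₀)` on `ball x₀ r` would be a larger minorant. -/
theorem exists_coneEnvelope_add_coneCost_lt (hL : 0 ≤ L) (hδ : 0 < δ) (hM : ∀ x ∈ K, |H x| ≤ M)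
    {x₀ : E} (hx₀ : x₀ ∈ K) {η r : ℝ} (hη : 0 < η) (hr : 0 < r)
    (hroom : ∀ x ∈ K, dist x x₀ < r → coneEnvelope Q L δ K H x₀ + η ≤ H x) :
    ∃ x ∈ thickening δ K, r - δ ≤ dist x x₀ ∧ dist x x₀ < r ∧
      coneEnvelope Q L δ K H x + coneCost Q L δ (x - x₀) < coneEnvelope Q L δ K H x₀ + η := by
  by_contra! hcon
  set u := coneEnvelope Q L δ K H with hu
  have hum : u ∈ coneMinorants Q L δ K H := coneEnvelope_mem hL hδ.le hM
  have hcost : ∀ z, 0 ≤ coneCost Q L δ z := fun z => by unfold coneCost; positivity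
  let q : E → ℝ := fun x => u x₀ + η - coneCost Q L δ (x - x₀)
  classical
  let g : E → ℝ := fun x => if dist x x₀ < r then max (u x) (q x) else u x
  have hug : ∀ x, u x ≤ g x := fun x => by
    simp only [g]
    split_ifs
    exacts [le_max_left _ _, le_rfl]
  have hg : g ∈ coneMinorants Q L δ K H := by
    refine ⟨fun x hx => ?_, fun x hx y hy hxy => ?_⟩
    · simp only [g]
      split_ifs with h
      · refine max_le (hum.1 x hx) ?_
        have := hroom x hx h
        have := hcost (x - x₀)
        simp only [q]
        linarith
      · exact hum.1 x hx
    · have hux : u x ≤ g y + coneCost Q L δ (x - y) :=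
        (hum.2 x hx y hy hxy).trans (by gcongr; exact hug y)
      by_cases h : dist x x₀ < r
      · have hgx : g x = max (u x) (q x) := if_pos h
        rw [hgx]
        refine max_le hux ?_
        by_cases hy' : dist y x₀ < r
        · have hgy : q y ≤ g y := by
            simp only [g, if_pos hy']
            exact le_max_right _ _
          have h1 := coneCost_add_le (Q := Q) hL hδ.le (y - x) (x - x₀)
          rw [sub_add_sub_cancel, coneCost_sub_comm y x] at h1
          simp only [q] at hgy ⊢
          linarith
        · have h1 : r - δ ≤ dist x x₀ := by
            have := dist_triangle y x x₀
            rw [dist_comm y x] at this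
            linarith
          have := hcon x hx h1 h
          refine le_trans ?_ hux
          simp only [q]
          linarith
      · have hgx : g x = u x := if_neg h
        rwa [hgx]
  -- At `x₀` the minorant `g` exceeds the envelope by `η`.
  have h1 := le_coneEnvelope hL hδ.le hM hg (self_subset_thickening hδ K hx₀)
  have h2 : u x₀ + η ≤ g x₀ := by
    simp only [g, dist_self, if_pos hr, q, sub_self, coneCost_zero, sub_zero]
    exact le_max_right _ _
  rw [← hu] at h1
  linarith

theorem IsCompact.exists_pos_abs_le {X : Type*} [TopologicalSpace X] {K : Set X} {H : X → ℝ}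
    (hK : IsCompact K) (hH : ContinuousOn H K) :
    ∃ M : ℝ, 0 < M ∧ ∀ x ∈ K, |H x| ≤ M := by
  obtain ⟨M, hM⟩ := hK.exists_bound_of_continuousOn hH
  exact ⟨max M 1, by positivity, fun x hx => (hM x hx).trans (le_max_left _ _)⟩

/-- As `δ → 0` the envelopes converge to `H` on `K`. Otherwise the limit `h` of `H - coneEnvelope`
has a positive maximum over `K`, at `x₀` say; by `exists_coneEnvelope_add_coneCost_lt` there is a point `x' ∈ K` with
`x' - x₀ ∈ ker Q`, at a small distance `r` from `x₀`, at which the limit of the envelopes is smaller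
by `L r`, while `H` is smaller by hardly more than `ε r < L r`. -/
theorem iInf_sub_coneEnvelope_nonpos [ProperSpace E] (hK : IsCompact K)
    (hH : ∀ x ∈ K, DifferentiableAt ℝ H x) {ε : ℝ} (hε : 0 ≤ ε) (hεL : ε < L)
    (hD : ∀ x ∈ K, ∀ v, Q v = 0 → |fderiv ℝ H x v| ≤ ε * ‖v‖) {x : E} (hx : x ∈ K) :
    ⨅ n : ℕ, (H x - coneEnvelope Q L (1 / ((n : ℝ) + 1)) K H x) ≤ 0 := by
  have hL : 0 ≤ L := hε.trans hεL.le
  have hHc : ContinuousOn H K := fun x hx => (hH x hx).continuousAt.continuousWithinAt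
  obtain ⟨M, hM0, hM⟩ := hK.exists_pos_abs_le hHc
  let d : ℕ → ℝ := fun n => 1 / ((n : ℝ) + 1)
  have hd : ∀ n, 0 < d n := fun n => Nat.one_div_pos_of_nat
  have hdlim : Tendsto d atTop (𝓝 0) := tendsto_one_div_add_atTop_nhds_zero_nat
  have hdanti : ∀ {j n}, j ≤ n → d n ≤ d j := fun h => Nat.one_div_le_one_div h
  let u : ℕ → E → ℝ := fun n => coneEnvelope Q L (d n) K H
  have hum : ∀ n, u n ∈ coneMinorants Q L (d n) K H := fun n => coneEnvelope_mem hL (hd n).le hM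
  have huc : ∀ n, ContinuousOn (u n) (thickening (d n) K) := fun n =>
    continuousOn_of_coneCost hL (hd n) (hum n).2
  have hsub : ∀ n, K ⊆ thickening (d n) K := fun n => self_subset_thickening (hd n) K
  let h : E → ℝ := fun x => ⨅ n, (H x - u n x)
  have hbdd : ∀ x ∈ K, BddBelow (Set.range fun n => H x - u n x) := by
    intro x hx
    refine ⟨0, ?_⟩
    rintro _ ⟨n, rfl⟩
    exact sub_nonneg.2 ((hum n).1 x hx)
  have husc : UpperSemicontinuousOn h K := upperSemicontinuousOn_ciInf hbdd fun n =>
    (hHc.sub ((huc n).mono (hsub n))).upperSemicontinuousOn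
  obtain ⟨x₀, hx₀, hmax⟩ := husc.exists_isMaxOn ⟨x, hx⟩ hK
  suffices h x₀ ≤ 0 from (hmax hx).trans this
  by_contra! hm
  set m := h x₀ with hmdef
  have hux₀ : ∀ n, u n x₀ ≤ H x₀ - m := fun n => by
    have := ciInf_le (hbdd x₀ hx₀) n
    change m ≤ _ at this
    linarith
  let κ := (L - ε) / 2
  have hκ : 0 < κ := by simp only [κ]; linarith
  obtain ⟨r₁, hr₁, hr₁'⟩ := Metric.eventually_nhds_iff.1
    ((hH x₀ hx₀).hasFDerivAt.isLittleO.bound hκ)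
  obtain ⟨r₂, hr₂, hr₂'⟩ := Metric.continuousAt_iff.1 (hH x₀ hx₀).continuousAt (m / 2) (by linarith)
  let r := min r₁ r₂ / 2
  have hr : 0 < r := by simp only [r]; positivity
  have hrr₁ : r < r₁ := by
    have := min_le_left r₁ r₂
    simp only [r]; linarith
  have hrr₂ : r < r₂ := by
    have := min_le_right r₁ r₂
    simp only [r]; linarith
  -- The excess `m / 2 * d n` fits below `H` on `ball x₀ r` and vanishes in the limit.
  have hex : ∀ n, ∃ x ∈ thickening (d n) K, r - d n ≤ dist x x₀ ∧ dist x x₀ < r ∧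
      u n x + coneCost Q L (d n) (x - x₀) < u n x₀ + m / 2 * d n := by
    intro n
    refine exists_coneEnvelope_add_coneCost_lt hL (hd n) hM hx₀ (mul_pos (by linarith) (hd n)) hr
      fun x _ hxr => ?_
    have h1 := (abs_lt.1 (hr₂' (hxr.trans hrr₂))).1
    have h2 : m / 2 * d n ≤ m / 2 * d 0 := by gcongr; exact hdanti (Nat.zero_le n)
    have h3 : d 0 = 1 := by simp [d]
    have := hux₀ n
    rw [h3] at h2
    change u n x₀ + _ ≤ _
    linarith
  choose y hyU hyr hyr' hyu using hex
  obtain ⟨x', -, φ, hφ, hlim⟩ := (isCompact_closedBall x₀ r).tendsto_subseq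
    (fun n => mem_closedBall.2 (hyr' n).le)
  have hdφ : Tendsto (fun n => d (φ n)) atTop (𝓝 0) := hdlim.comp hφ.tendsto_atTop
  have hx'K : x' ∈ K := by
    choose k hkK hk using fun n => mem_thickening_iff.1 (hyU n)
    have h1 : Tendsto (fun n => dist (y (φ n)) (k (φ n))) atTop (𝓝 0) :=
      squeeze_zero (fun _ => dist_nonneg) (fun n => (hk (φ n)).le) hdφ
    have h2 : Tendsto (fun n => k (φ n)) atTop (𝓝 x') := (tendsto_iff_of_dist h1).1 hlim
    exact hK.isClosed.mem_of_tendsto h2 (Eventually.of_forall fun n => hkK _)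
  have hx'r : dist x' x₀ = r := by
    have h1 : Tendsto (fun n => dist (y (φ n)) x₀) atTop (𝓝 (dist x' x₀)) :=
      hlim.dist tendsto_const_nhds
    refine le_antisymm (le_of_tendsto h1 (Eventually.of_forall fun n => (hyr' _).le)) ?_
    have h2 : Tendsto (fun n => r - d (φ n)) atTop (𝓝 (r - 0)) := tendsto_const_nhds.sub hdφ
    rw [sub_zero] at h2
    exact le_of_tendsto_of_tendsto' h2 h1 fun n => hyr _
  have hx'Q : Q (x' - x₀) = 0 := by
    have h1 : Tendsto (fun n => ‖Q (y (φ n) - x₀)‖) atTop (𝓝 ‖Q (x' - x₀)‖) :=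
      ((Q.continuous.tendsto _).comp (hlim.sub_const x₀)).norm
    have h2 : ∀ n, ‖Q (y n - x₀)‖ ≤ d n * (M + M + m / 2) := by
      intro n
      have h3 := hyu n
      have h4 : -M ≤ u n (y n) :=
        le_coneEnvelope hL (hd n).le hM (const_mem_coneMinorants hL (hd n).le hM) (hyU n)
      have h5 := (hum n).1 x₀ hx₀
      have h6 := (abs_le.1 (hM x₀ hx₀)).2
      have h7 : m / 2 * d n ≤ m / 2 * 1 := by
        gcongr
        exact (hdanti (Nat.zero_le n)).trans (by simp [d])
      have h8 : (d n)⁻¹ * ‖Q (y n - x₀)‖ ≤ M + M + m / 2 := by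
        have : 0 ≤ L * ‖y n - x₀‖ := by positivity
        unfold coneCost at h3
        linarith
      rwa [inv_mul_le_iff₀ (hd n)] at h8
    have h3 : Tendsto (fun n => d (φ n) * (M + M + m / 2)) atTop (𝓝 0) := by
      simpa using hdφ.mul_const (M + M + m / 2)
    exact norm_eq_zero.1 (tendsto_nhds_unique h1
      (squeeze_zero (fun _ => norm_nonneg _) (fun n => h2 _) h3))
  have hux' : ∀ j, u j x' + L * r ≤ H x₀ - m := by
    intro j
    have hcont : Tendsto (fun n => u j (y (φ n))) atTop (𝓝 (u j x')) :=
      ((huc j).continuousAt (isOpen_thickening.mem_nhds (hsub j hx'K))).tendsto.comp hlim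
    have h1 : Tendsto (fun n => u j (y (φ n)) + L * dist (y (φ n)) x₀) atTop
        (𝓝 (u j x' + L * dist x' x₀)) :=
      hcont.add ((hlim.dist tendsto_const_nhds).const_mul L)
    have h2 : Tendsto (fun n => H x₀ - m + m / 2 * d (φ n)) atTop (𝓝 (H x₀ - m + m / 2 * 0)) :=
      tendsto_const_nhds.add (hdφ.const_mul _)
    rw [mul_zero, add_zero] at h2
    rw [← hx'r]
    refine le_of_tendsto_of_tendsto h1 h2 ?_
    filter_upwards [eventually_ge_atTop j] with n hn
    have h3 : u j (y (φ n)) ≤ u (φ n) (y (φ n)) :=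
      coneEnvelope_mono hL (hd _) (hdanti (hn.trans (hφ.id_le n))) hM (hyU _)
    have h4 := hyu (φ n)
    have h5 := norm_mul_le_coneCost (Q := Q) (L := L) (hd (φ n)).le (y (φ n) - x₀)
    have h6 := hux₀ (φ n)
    rw [dist_eq_norm]
    linarith
  have hHx' : H x₀ - ε * r - κ * r ≤ H x' := by
    have h1 := hr₁' (hx'r.trans_lt hrr₁)
    rw [← dist_eq_norm x' x₀, hx'r, Real.norm_eq_abs] at h1
    have h2 := hD x₀ hx₀ _ hx'Q
    rw [← dist_eq_norm x' x₀, hx'r] at h2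
    have h3 := (abs_le.1 h1).1
    have h4 := (abs_le.1 h2).1
    linarith
  have hfin : m + κ * r ≤ h x' := le_ciInf fun j => by
    have h1 := hux' j
    have h2 : κ * r + κ * r = (L - ε) * r := by simp only [κ]; ring
    linarith
  have := hmax hx'K
  change h x' ≤ m at this
  have := mul_pos hκ hr
  linarith

/-- By Dini's theorem the envelopes, being monotone in `δ`, converge to `H` uniformly on `K`. -/
theorem exists_coneCost_approx [ProperSpace E] (hK : IsCompact K)
    (hH : ∀ x ∈ K, DifferentiableAt ℝ H x) {ε : ℝ} (hε : 0 ≤ ε) (hεL : ε < L)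
    (hD : ∀ x ∈ K, ∀ v, Q v = 0 → |fderiv ℝ H x v| ≤ ε * ‖v‖) {η : ℝ} (hη : 0 < η) :
    ∃ δ > 0, ∃ g : E → ℝ, (∀ x ∈ K, |g x - H x| < η) ∧
      ∀ x ∈ thickening δ K, ∀ y ∈ thickening δ K, dist x y < δ →
        g x ≤ g y + coneCost Q L δ (x - y) := by
  have hL : 0 ≤ L := hε.trans hεL.le
  have hHc : ContinuousOn H K := fun x hx => (hH x hx).continuousAt.continuousWithinAt
  obtain ⟨M, hM0, hM⟩ := hK.exists_pos_abs_le hHc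
  let d : ℕ → ℝ := fun n => 1 / ((n : ℝ) + 1)
  have hd : ∀ n, 0 < d n := fun n => Nat.one_div_pos_of_nat
  let u : ℕ → E → ℝ := fun n => coneEnvelope Q L (d n) K H
  have hum : ∀ n, u n ∈ coneMinorants Q L (d n) K H := fun n => coneEnvelope_mem hL (hd n).le hM
  have hanti : ∀ x ∈ K, Antitone fun n => H x - u n x := fun x hx j n hjn =>
    sub_le_sub_left (coneEnvelope_mono hL (hd n) (Nat.one_div_le_one_div hjn) hM
      (self_subset_thickening (hd n) K hx)) _
  have hlim : ∀ x ∈ K, Tendsto (fun n => H x - u n x) atTop (𝓝 0) := by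
    intro x hx
    have hb : BddBelow (Set.range fun n => H x - u n x) := by
      refine ⟨0, ?_⟩
      rintro _ ⟨n, rfl⟩
      exact sub_nonneg.2 ((hum n).1 x hx)
    have h1 := tendsto_atTop_ciInf (hanti x hx) hb
    have h2 : ⨅ n, (H x - u n x) = 0 :=
      le_antisymm (iInf_sub_coneEnvelope_nonpos hK hH hε hεL hD hx)
        (le_ciInf fun n => sub_nonneg.2 ((hum n).1 x hx))
    rwa [h2] at h1
  have hunif : TendstoUniformlyOn (fun n x => H x - u n x) (fun _ => 0) atTop K :=
    Antitone.tendstoUniformlyOn_of_forall_tendsto hK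
      (fun n => hHc.sub ((continuousOn_of_coneCost hL (hd n) (hum n).2).mono
        (self_subset_thickening (hd n) K))) hanti continuousOn_const hlim
  obtain ⟨n, hn⟩ := (Metric.tendstoUniformlyOn_iff.1 hunif η hη).exists
  refine ⟨d n, hd n, u n, fun x hx => ?_, (hum n).2⟩
  have := hn x hx
  rwa [dist_zero_left, Real.norm_eq_abs, abs_sub_comm] at this

end ConeCost

/-! ### Gluing local approximations -/

section Gluing

variable {E F : Type*} [NormedAddCommGroup E] [NormedSpace ℝ E] [FiniteDimensional ℝ E]
  [NormedAddCommGroup F] [NormedSpace ℝ F] {Q : E →L[ℝ] F} {K : Set E} {H : E → ℝ}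

open scoped Manifold in
/-- Local approximations, uniform in the values and in the derivative along `ker Q`, are glued by a
partition of unity `χ`; the terms `(f i - H) • Dχ i` are controlled by the closeness of the
values. -/
theorem exists_contDiff_approx_of_local {ι : Type*} [Fintype ι] (hK : IsCompact K) {U : ι → Set E}
    (hU : ∀ i, IsOpen (U i)) (hcov : Set.univ ⊆ ⋃ i, U i) {ε : ℝ} (hε : 0 < ε)
    (hloc : ∀ i, ∀ η > 0, ∃ f : E → ℝ, ContDiff ℝ ∞ f ∧ ∀ x ∈ K ∩ U i,
      |f x - H x| ≤ η ∧ ∀ v, Q v = 0 → |(fderiv ℝ f x - fderiv ℝ H x) v| ≤ ε * ‖v‖) :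
    ∃ f : E → ℝ, ContDiff ℝ ∞ f ∧ ∀ x ∈ K, ∀ v, Q v = 0 →
      |(fderiv ℝ f x - fderiv ℝ H x) v| ≤ 2 * ε * ‖v‖ := by
  obtain ⟨χ, hχ⟩ := SmoothPartitionOfUnity.exists_isSubordinate 𝓘(ℝ, E) isClosed_univ U hU hcov
  have hχs : ∀ i, ContDiff ℝ ∞ (χ i) := fun i => (χ i).contMDiff.contDiff
  have hχd : ∀ i x, HasFDerivAt (χ i) (fderiv ℝ (χ i) x) x := fun i x =>
    ((hχs i).differentiable (by simp) x).hasFDerivAt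
  have hsum : ∀ x, ∑ i, χ i x = 1 := fun x => by
    rw [← finsum_eq_sum_of_fintype]
    exact χ.sum_eq_one (Set.mem_univ x)
  have hdsum : ∀ x, ∑ i, fderiv ℝ (χ i) x = 0 := by
    intro x
    have h1 : HasFDerivAt (fun x => ∑ i, χ i x) (∑ i, fderiv ℝ (χ i) x) x :=
      HasFDerivAt.fun_sum fun i _ => hχd i x
    rw [funext hsum] at h1
    exact h1.unique (hasFDerivAt_const _ _)
  have hC : ∀ i, ∃ C : ℝ, ∀ x ∈ K, ‖fderiv ℝ (χ i) x‖ ≤ C := fun i =>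
    hK.exists_bound_of_continuousOn ((hχs i).continuous_fderiv (by simp)).continuousOn
  choose C hC using hC
  set S := ∑ i, |C i| with hS
  have hS0 : 0 ≤ S := Finset.sum_nonneg fun i _ => abs_nonneg _
  have hη : 0 < ε / (S + 1) := by positivity
  choose f hf hfK using fun i => hloc i (ε / (S + 1)) hη
  have hfd : ∀ i x, HasFDerivAt (f i) (fderiv ℝ (f i) x) x := fun i x =>
    ((hf i).differentiable (by simp) x).hasFDerivAt
  refine ⟨fun x => ∑ i, χ i x * f i x, ContDiff.sum fun i _ => (hχs i).mul (hf i),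
    fun x hx v hv => ?_⟩
  have h1 : HasFDerivAt (fun x => ∑ i, χ i x * f i x)
      (∑ i, (χ i x • fderiv ℝ (f i) x + f i x • fderiv ℝ (χ i) x)) x :=
    HasFDerivAt.fun_sum fun i _ => (hχd i x).mul (hfd i x)
  -- `∑ Dχ i = 0` allows `H` to be subtracted from the coefficient `f i` of `Dχ i`.
  have h2 : (fderiv ℝ (fun x => ∑ i, χ i x * f i x) x - fderiv ℝ H x) v =
      ∑ i, (χ i x * (fderiv ℝ (f i) x - fderiv ℝ H x) v +
        (f i x - H x) * fderiv ℝ (χ i) x v) := by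
    have h3 : ∑ i, fderiv ℝ (χ i) x v = 0 := by
      rw [← sum_apply, hdsum x]
      rfl
    rw [h1.fderiv]
    simp only [sub_apply, sum_apply,
      add_apply, smul_apply, smul_eq_mul, mul_sub, sub_mul,
      Finset.sum_add_distrib, Finset.sum_sub_distrib, ← Finset.sum_mul, ← Finset.mul_sum, hsum x, h3]
    ring
  rw [h2]
  have hterm : ∀ i, |χ i x * (fderiv ℝ (f i) x - fderiv ℝ H x) v +
      (f i x - H x) * fderiv ℝ (χ i) x v| ≤
      χ i x * (ε * ‖v‖) + ε / (S + 1) * (|C i| * ‖v‖) := by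
    intro i
    have hpos : 0 ≤ χ i x := χ.nonneg i x
    by_cases hxi : x ∈ tsupport (χ i)
    · obtain ⟨h3, h4⟩ := hfK i x ⟨hx, hχ i hxi⟩
      refine (abs_add_le _ _).trans ?_
      rw [abs_mul, abs_mul, abs_of_nonneg hpos]
      have h5 : |fderiv ℝ (χ i) x v| ≤ |C i| * ‖v‖ :=
        (fderiv ℝ (χ i) x).le_of_opNorm_le ((hC i x hx).trans (le_abs_self _)) v
      exact add_le_add (mul_le_mul_of_nonneg_left (h4 v hv) hpos)
        (mul_le_mul h3 h5 (abs_nonneg _) hη.le)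
    · have h3 : χ i x = 0 := image_eq_zero_of_notMem_tsupport hxi
      have h4 : fderiv ℝ (χ i) x = 0 :=
        image_eq_zero_of_notMem_tsupport fun h => hxi (tsupport_fderiv_subset ℝ h)
      rw [h3, h4]
      simp
      positivity
  calc _ ≤ ∑ i, (χ i x * (ε * ‖v‖) + ε / (S + 1) * (|C i| * ‖v‖)) :=
        (Finset.abs_sum_le_sum_abs _ _).trans (Finset.sum_le_sum fun i _ => hterm i)
    _ = (ε + ε / (S + 1) * S) * ‖v‖ := by
        rw [Finset.sum_add_distrib, ← Finset.sum_mul, ← Finset.mul_sum, ← Finset.sum_mul, hsum x]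
        ring
    _ ≤ (ε + ε / (S + 1) * (S + 1)) * ‖v‖ := by
        gcongr
        linarith
    _ = 2 * ε * ‖v‖ := by
        field_simp
        ring

end Gluing

/-! ### Smooth approximation of the derivative along `ker Q` -/

section Smoothing

variable {E F : Type*} [NormedAddCommGroup E] [NormedSpace ℝ E] [FiniteDimensional ℝ E]
  [MeasurableSpace E] [BorelSpace E] [NormedAddCommGroup F] [NormedSpace ℝ F]
  {Q : E →L[ℝ] F} {L : ℝ} {K : Set E} {H : E → ℝ}

/-- A function whose derivative along `ker Q` is at most `ε < L` at every point of `K` is a uniform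
limit on `K` of smooth functions whose derivative along `ker Q` is at most `L` on `K`. No
differentiability off `K`, and no uniformity on `K`, is needed. -/
theorem exists_contDiff_abs_sub_le_of_fderiv_le (hK : IsCompact K)
    (hH : ∀ x ∈ K, DifferentiableAt ℝ H x) {ε : ℝ} (hε : 0 ≤ ε) (hεL : ε < L)
    (hD : ∀ x ∈ K, ∀ v, Q v = 0 → |fderiv ℝ H x v| ≤ ε * ‖v‖) {η : ℝ} (hη : 0 < η) :
    ∃ f : E → ℝ, ContDiff ℝ ∞ f ∧ (∀ x ∈ K, |f x - H x| ≤ η) ∧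
      ∀ x ∈ K, ∀ v, Q v = 0 → |fderiv ℝ f x v| ≤ L * ‖v‖ := by
  have hL : 0 ≤ L := hε.trans hεL.le
  let μ : Measure E := Measure.addHaar
  have hHc : ContinuousOn H K := fun x hx => (hH x hx).continuousAt.continuousWithinAt
  obtain ⟨M, hM0, hM⟩ := hK.exists_pos_abs_le hHc
  obtain ⟨δ, hδ, g, hgH, hg⟩ := exists_coneCost_approx hK hH hε hεL hD (half_pos hη)
  set U := thickening δ K with hU
  have hUo : IsOpen U := isOpen_thickening
  have hKU : K ⊆ U := self_subset_thickening hδ K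
  set C := L + δ⁻¹ * ‖Q‖ with hC
  have hC0 : 0 ≤ C := by positivity
  let G : E → ℝ := U.indicator g
  have hGg : ∀ x ∈ U, G x = g x := fun x hx => Set.indicator_of_mem hx g
  have hGi : Integrable G μ := by
    refine IntegrableOn.integrable_indicator ?_ hUo.measurableSet
    have hfin : μ U < ⊤ := hK.isBounded.thickening.measure_lt_top
    refine IntegrableOn.of_bound hfin
      ((continuousOn_of_coneCost hL hδ hg).aestronglyMeasurable hUo.measurableSet)
      (M + η + C * δ) ?_
    filter_upwards [ae_restrict_mem hUo.measurableSet] with x hx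
    obtain ⟨z, hz, hxz⟩ := mem_thickening_iff.1 hx
    have h1 := abs_sub_le_coneCost hg hx (hKU hz) hxz
    have h2 : coneCost Q L δ (x - z) ≤ C * δ :=
      (coneCost_le hδ.le _).trans (by rw [← dist_eq_norm]; gcongr)
    have h3 := hgH z hz
    have h4 := hM z hz
    rw [Real.norm_eq_abs]
    have h5 : |g x| ≤ |g x - g z| + |g z - H z| + |H z| := by
      have := abs_add_three (g x - g z) (g z - H z) (H z)
      rwa [sub_add_sub_cancel, sub_add_cancel] at this
    linarith
  obtain ⟨ρ, hρ, hρδ, hρη⟩ : ∃ ρ > 0, ρ ≤ δ / 2 ∧ C * ρ ≤ η / 2 := by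
    refine ⟨min (δ / 2) (η / 2 / (C + 1)), by positivity, min_le_left _ _, ?_⟩
    calc C * min (δ / 2) (η / 2 / (C + 1)) ≤ (C + 1) * (η / 2 / (C + 1)) :=
          mul_le_mul (by linarith) (min_le_right _ _) (by positivity) (by positivity)
      _ = η / 2 := by field_simp
  let φ : ContDiffBump (0 : E) := ⟨ρ / 2, ρ, by linarith, by linarith⟩
  let f := convolution (φ.normed μ) G (lsmul ℝ ℝ) μ
  have hf : ContDiff ℝ ∞ f :=
    φ.hasCompactSupport_normed.contDiff_convolution_left (n := ⊤) (lsmul ℝ ℝ) φ.contDiff_normed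
      hGi.locallyIntegrable
  refine ⟨f, hf, fun x hx => ?_, fun x hx v hv => ?_⟩
  · have h1 := φ.dist_normed_convolution_le (μ := μ) (g := G) (x₀ := x) (ε := η / 2)
      hGi.aestronglyMeasurable (fun y hy => by
        have hyx : dist y x < ρ := hy
        have hyU : y ∈ U := mem_thickening_iff.2 ⟨x, hx, by linarith⟩
        rw [hGg y hyU, hGg x (hKU hx), Real.dist_eq]
        refine (abs_sub_le_coneCost hg hyU (hKU hx) (by linarith)).trans ?_
        refine (coneCost_le hδ.le _).trans (le_trans ?_ hρη)
        rw [← dist_eq_norm]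
        gcongr)
    rw [hGg x (hKU hx), Real.dist_eq] at h1
    have h2 := hgH x hx
    have h3 := abs_sub_le (f x) (g x) (H x)
    change |f x - g x| ≤ _ at h1
    linarith
  · have hline : HasDerivAt (fun s : ℝ => f (x + s • v)) (fderiv ℝ f x v) 0 := by
      have h1 : HasDerivAt (fun s : ℝ => x + s • v) v 0 := by
        simpa using ((hasDerivAt_id (0 : ℝ)).smul_const v).const_add x
      have h2 : HasFDerivAt f (fderiv ℝ f x) (x + (0 : ℝ) • v) := by
        rw [zero_smul, add_zero]
        exact (hf.differentiable (by simp) x).hasFDerivAt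
      exact h2.comp_hasDerivAt 0 h1
    refine hline.le_of_lip' (by positivity) ?_
    have hsmall : ∀ᶠ s : ℝ in 𝓝 0, ‖s • v‖ < δ / 2 := by
      have : Tendsto (fun s : ℝ => ‖s • v‖) (𝓝 0) (𝓝 ‖(0 : ℝ) • v‖) :=
        (continuous_id.smul continuous_const).norm.tendsto 0
      rw [zero_smul, norm_zero] at this
      exact this.eventually (gt_mem_nhds (half_pos hδ))
    filter_upwards [hsmall] with s hs
    have hce : ∀ y, Integrable (fun t => φ.normed μ t • G (y - t)) μ := fun y =>
      φ.hasCompactSupport_normed.convolutionExists_left (lsmul ℝ ℝ) φ.continuous_normed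
        hGi.locallyIntegrable y
    rw [zero_smul, add_zero, sub_zero]
    change ‖∫ t, φ.normed μ t • G (x + s • v - t) ∂μ - ∫ t, φ.normed μ t • G (x - t) ∂μ‖ ≤ _
    rw [← integral_sub (hce _) (hce _)]
    have hb : ∀ t, ‖φ.normed μ t • G (x + s • v - t) - φ.normed μ t • G (x - t)‖ ≤
        φ.normed μ t * (L * ‖s • v‖) := by
      intro t
      rw [← smul_sub, norm_smul, Real.norm_of_nonneg (φ.nonneg_normed t)]
      by_cases ht : φ.normed μ t = 0
      · simp [ht]
      · have ht' : ‖t‖ < ρ := by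
          have : t ∈ Function.support (φ.normed μ) := ht
          rw [φ.support_normed_eq] at this
          simpa using this
        have hU1 : x - t ∈ U := mem_thickening_iff.2 ⟨x, hx, by
          rw [dist_eq_norm, sub_sub_cancel_left, norm_neg]
          linarith⟩
        have hU2 : x + s • v - t ∈ U := mem_thickening_iff.2 ⟨x, hx, by
          rw [dist_eq_norm]
          have : x + s • v - t - x = s • v - t := by abel
          rw [this]
          have := norm_sub_le (s • v) t
          linarith⟩
        have hdiff : x + s • v - t - (x - t) = s • v := by abel
        refine mul_le_mul_of_nonneg_left ?_ (φ.nonneg_normed t)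
        rw [hGg _ hU1, hGg _ hU2, Real.norm_eq_abs]
        refine (abs_sub_le_coneCost hg hU2 hU1 (by rw [dist_eq_norm, hdiff]; linarith)).trans ?_
        rw [hdiff, coneCost_of_ker (by rw [map_smul, hv, smul_zero])]
    refine (norm_integral_le_of_norm_le (φ.integrable_normed.mul_const _)
      (Eventually.of_forall hb)).trans_eq ?_
    rw [integral_mul_const, φ.integral_normed, one_mul, norm_smul]
    ring

/-- If the derivative of `H` along `ker Q` is continuous on `K`, then near a point of `K` the
function `H` is, up to a linear function, one with small derivative along `ker Q`. -/
theorem exists_local_contDiff_approx (hK : IsCompact K) (hH : ∀ x ∈ K, DifferentiableAt ℝ H x)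
    (hc : ∀ x ∈ K, ∀ ε > 0, ∃ r > 0, ∀ y ∈ K, dist y x < r → ∀ v, Q v = 0 →
      |(fderiv ℝ H y - fderiv ℝ H x) v| ≤ ε * ‖v‖)
    {ε : ℝ} (hε : 0 < ε) {x₀ : E} (hx₀ : x₀ ∈ K) :
    ∃ r > 0, ∀ η > 0, ∃ f : E → ℝ, ContDiff ℝ ∞ f ∧ ∀ x ∈ K ∩ closedBall x₀ r,
      |f x - H x| ≤ η ∧ ∀ v, Q v = 0 → |(fderiv ℝ f x - fderiv ℝ H x) v| ≤ ε * ‖v‖ := by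
  obtain ⟨r, hr, hr'⟩ := hc x₀ hx₀ (ε / 3) (by positivity)
  have hD : ∀ x ∈ K ∩ closedBall x₀ (r / 2), ∀ v, Q v = 0 →
      |(fderiv ℝ H x - fderiv ℝ H x₀) v| ≤ ε / 3 * ‖v‖ := fun x hx =>
    hr' x hx.1 ((mem_closedBall.1 hx.2).trans_lt (by linarith))
  have hfd : ∀ x ∈ K, HasFDerivAt (fun x => H x - fderiv ℝ H x₀ x)
      (fderiv ℝ H x - fderiv ℝ H x₀) x := fun x hx =>
    (hH x hx).hasFDerivAt.sub (fderiv ℝ H x₀).hasFDerivAt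
  refine ⟨r / 2, by positivity, fun η hη => ?_⟩
  obtain ⟨f, hf, hf1, hf2⟩ := exists_contDiff_abs_sub_le_of_fderiv_le (Q := Q) (L := 2 * ε / 3)
    (K := K ∩ closedBall x₀ (r / 2)) (H := fun x => H x - fderiv ℝ H x₀ x)
    (hK.inter_right isClosed_closedBall) (fun x hx => (hfd x hx.1).differentiableAt)
    (ε := ε / 3) (by positivity) (by linarith)
    (fun x hx v hv => by rw [(hfd x hx.1).fderiv]; exact hD x hx v hv) hη
  refine ⟨fun x => f x + fderiv ℝ H x₀ x, hf.add (fderiv ℝ H x₀).contDiff, fun x hx => ⟨?_, ?_⟩⟩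
  · have := hf1 x hx
    rwa [← sub_add, ← add_sub_right_comm] at this
  · intro v hv
    have h1 : HasFDerivAt (fun x => f x + fderiv ℝ H x₀ x) (fderiv ℝ f x + fderiv ℝ H x₀) x :=
      ((hf.differentiable (by simp)) x).hasFDerivAt.add (fderiv ℝ H x₀).hasFDerivAt
    rw [h1.fderiv]
    have h2 : (fderiv ℝ f x + fderiv ℝ H x₀ - fderiv ℝ H x) v =
        fderiv ℝ f x v - (fderiv ℝ H x - fderiv ℝ H x₀) v := by
      simp only [sub_apply, add_apply]
      ring
    rw [h2]
    have h3 := hf2 x hx v hv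
    have h4 := hD x hx v hv
    have h5 := abs_sub (fderiv ℝ f x v) ((fderiv ℝ H x - fderiv ℝ H x₀) v)
    linarith

/-- If the derivative of `H` along `ker Q` is continuous on `K`, then it is a uniform limit on `K` of
the derivatives along `ker Q` of smooth functions. -/
theorem exists_contDiff_fderiv_approx (hK : IsCompact K) (hH : ∀ x ∈ K, DifferentiableAt ℝ H x)
    (hc : ∀ x ∈ K, ∀ ε > 0, ∃ r > 0, ∀ y ∈ K, dist y x < r → ∀ v, Q v = 0 →
      |(fderiv ℝ H y - fderiv ℝ H x) v| ≤ ε * ‖v‖)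
    {ε : ℝ} (hε : 0 < ε) :
    ∃ f : E → ℝ, ContDiff ℝ ∞ f ∧ ∀ x ∈ K, ∀ v, Q v = 0 →
      |(fderiv ℝ f x - fderiv ℝ H x) v| ≤ ε * ‖v‖ := by
  choose! r hr hloc using fun x₀ (hx₀ : x₀ ∈ K) =>
    exists_local_contDiff_approx hK hH hc (half_pos hε) hx₀
  obtain ⟨t, htK, ht⟩ := hK.elim_nhds_subcover (fun x => ball x (r x))
    fun x hx => ball_mem_nhds x (hr x hx)
  -- The open set `Kᶜ`, on which nothing is required, completes the balls to a cover of `E`.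
  let U : Option t → Set E := fun i => i.elim Kᶜ fun x => ball x.1 (r x.1)
  have key := exists_contDiff_approx_of_local (Q := Q) (H := H) hK (U := U) (fun i => ?_) ?_
    (half_pos hε) (fun i η hη => ?_)
  · simpa [mul_div_cancel₀] using key
  · cases i with
    | none => exact hK.isClosed.isOpen_compl
    | some x => exact isOpen_ball
  · intro x _
    by_cases hx : x ∈ K
    · obtain ⟨y, hy, hxy⟩ := Set.mem_iUnion₂.1 (ht hx)
      exact Set.mem_iUnion.2 ⟨some ⟨y, hy⟩, hxy⟩
    · exact Set.mem_iUnion.2 ⟨none, hx⟩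
  · cases i with
    | none => exact ⟨0, contDiff_const, fun x hx => absurd hx.1 hx.2⟩
    | some x =>
      obtain ⟨f, hf, hfK⟩ := hloc x.1 (htK x.1 x.2) η hη
      exact ⟨f, hf, fun y hy => hfK y ⟨hy.1, ball_subset_closedBall hy.2⟩⟩

end Smoothing

/-! ### Energy fields -/

section EnergyField

variable {N : ℕ}

/-- The derivative of `H` in the direction `Gᵀ z` is `⟪G ∂H/∂u, z⟫`, so the energy field carries
exactly the information on the derivative of `H` along the range of the transpose. -/
theorem fderiv_adjoint_apply (G : Matrix (Fin N) (Fin N) ℝ) (H : EuclideanSpace ℝ (Fin N) → ℝ)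
    (u z : EuclideanSpace ℝ (Fin N)) :
    fderiv ℝ H u (LinearMap.adjoint (Matrix.toEuclideanLin G) z) = inner ℝ (energyField G H u) z := by
  rw [energyField, ← LinearMap.adjoint_inner_right, gradient, InnerProductSpace.toDual_symm_apply]

/-- The energy field of `H` is, uniformly on `K`, a limit of energy fields of smooth functions. -/
theorem exists_contDiff_energyField_approx (G : Matrix (Fin N) (Fin N) ℝ)
    {H : EuclideanSpace ℝ (Fin N) → ℝ} {K : Set (EuclideanSpace ℝ (Fin N))} (hK : IsCompact K)
    (hH : ∀ u ∈ K, DifferentiableAt ℝ H u) (hc : ContinuousOn (energyField G H) K) {ε : ℝ}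
    (hε : 0 < ε) :
    ∃ f : EuclideanSpace ℝ (Fin N) → ℝ, ContDiff ℝ ∞ f ∧
      ∀ u ∈ K, ‖energyField G H u - energyField G f u‖ ≤ ε := by
  let A := LinearMap.adjoint (Matrix.toEuclideanLin G)
  -- A linear map whose kernel is the range of the adjoint.
  let Q := (LinearMap.range A)ᗮ.orthogonalProjectionOnto
  have hQ : LinearMap.ker (Q : EuclideanSpace ℝ (Fin N) →ₗ[ℝ] (LinearMap.range A)ᗮ) =
      LinearMap.range A := by
    rw [Submodule.ker_orthogonalProjectionOnto, Submodule.orthogonal_orthogonal]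
  obtain ⟨B, hB⟩ := A.rangeRestrict.exists_rightInverse_of_surjective A.range_rangeRestrict
  have hBA : ∀ v : LinearMap.range A, A (B v) = v := fun v =>
    congrArg Subtype.val (LinearMap.congr_fun hB v)
  let B' := B.toContinuousLinearMap
  have hcont : ∀ x ∈ K, ∀ ε > 0, ∃ r > 0, ∀ y ∈ K, dist y x < r → ∀ v, Q v = 0 →
      |(fderiv ℝ H y - fderiv ℝ H x) v| ≤ ε * ‖v‖ := by
    intro x hx ε hε
    obtain ⟨r, hr, hr'⟩ := Metric.continuousOn_iff.1 hc x hx (ε / (‖B'‖ + 1)) (by positivity)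
    refine ⟨r, hr, fun y hy hyx v hv => ?_⟩
    have hvA : v ∈ LinearMap.range A := hQ ▸ hv
    have h1 : (fderiv ℝ H y - fderiv ℝ H x) v =
        inner ℝ (energyField G H y - energyField G H x) (B' ⟨v, hvA⟩) := by
      have h2 : A (B' ⟨v, hvA⟩) = v := hBA ⟨v, hvA⟩
      rw [inner_sub_left, ← fderiv_adjoint_apply, ← fderiv_adjoint_apply, ← sub_apply]
      exact congrArg _ h2.symm
    have h3 := hr' y hy hyx
    rw [dist_eq_norm] at h3
    have h4 : ‖B' ⟨v, hvA⟩‖ ≤ ‖B'‖ * ‖v‖ := B'.le_opNorm ⟨v, hvA⟩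
    calc |(fderiv ℝ H y - fderiv ℝ H x) v|
        ≤ ‖energyField G H y - energyField G H x‖ * ‖B' ⟨v, hvA⟩‖ :=
          h1 ▸ abs_real_inner_le_norm _ _
      _ ≤ ε / (‖B'‖ + 1) * ((‖B'‖ + 1) * ‖v‖) := by
          gcongr
          exact h4.trans (mul_le_mul_of_nonneg_right (by linarith) (norm_nonneg _))
      _ = ε * ‖v‖ := by field_simp
  let A' := A.toContinuousLinearMap
  obtain ⟨f, hf, hfK⟩ := exists_contDiff_fderiv_approx hK hH hcont
    (ε := ε / (‖A'‖ + 1)) (by positivity)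
  refine ⟨f, hf, fun u hu => ?_⟩
  set w := energyField G H u - energyField G f u with hw
  have h1 : (fderiv ℝ H u - fderiv ℝ f u) (A w) = ‖w‖ ^ 2 := by
    rw [sub_apply, fderiv_adjoint_apply, fderiv_adjoint_apply, ← inner_sub_left, ← hw,
      real_inner_self_eq_norm_sq]
  have h2 : Q (A w) = 0 := by
    have : A w ∈ LinearMap.ker (Q : EuclideanSpace ℝ (Fin N) →ₗ[ℝ] (LinearMap.range A)ᗮ) :=
      by rw [hQ]; exact LinearMap.mem_range_self A w
    exact this
  have h3 := hfK u hu (A w) h2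
  rw [← neg_sub, neg_apply, abs_neg, h1, abs_of_nonneg (sq_nonneg _)] at h3
  have h4 : ‖A w‖ ≤ ‖A'‖ * ‖w‖ := A'.le_opNorm w
  have h5 : ‖w‖ ^ 2 ≤ ε * ‖w‖ := by
    calc ‖w‖ ^ 2 ≤ ε / (‖A'‖ + 1) * ‖A w‖ := h3
      _ ≤ ε / (‖A'‖ + 1) * ((‖A'‖ + 1) * ‖w‖) := by
          gcongr
          exact h4.trans (mul_le_mul_of_nonneg_right (by linarith) (norm_nonneg _))
      _ = ε * ‖w‖ := by field_simp
  by_contra! hlt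
  have := hε.trans hlt
  nlinarith

theorem norm_energyField_sub_le (G : Matrix (Fin N) (Fin N) ℝ)
    {f g : EuclideanSpace ℝ (Fin N) → ℝ} (u : EuclideanSpace ℝ (Fin N)) :
    ‖energyField G f u - energyField G g u‖ ≤
      ‖(Matrix.toEuclideanLin G).toContinuousLinearMap‖ *
        ‖iteratedFDeriv ℝ 1 f u - iteratedFDeriv ℝ 1 g u‖ := by
  have h1 : energyField G f u - energyField G g u =
      (Matrix.toEuclideanLin G).toContinuousLinearMap (gradient f u - gradient g u) := by
    simp [energyField]
  have h2 : ‖gradient f u - gradient g u‖ = ‖fderiv ℝ f u - fderiv ℝ g u‖ := by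
    rw [gradient, gradient, ← map_sub, LinearIsometryEquiv.norm_map]
  have h3 : ‖fderiv ℝ f u - fderiv ℝ g u‖ ≤
      ‖iteratedFDeriv ℝ 1 f u - iteratedFDeriv ℝ 1 g u‖ := by
    refine ContinuousLinearMap.opNorm_le_bound _ (norm_nonneg _) fun v => ?_
    have := (iteratedFDeriv ℝ 1 f u - iteratedFDeriv ℝ 1 g u).le_opNorm fun _ => v
    simpa using this
  rw [h1]
  refine (ContinuousLinearMap.le_opNorm _ _).trans ?_
  rw [h2]
  gcongr

/-- Uniform approximation of the energy field by those of networks. -/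
theorem exists_network_energyField_approx (G : Matrix (Fin N) (Fin N) ℝ)
    {H : EuclideanSpace ℝ (Fin N) → ℝ} {K : Set (EuclideanSpace ℝ (Fin N))} (hK : IsCompact K)
    (hH : ∀ u ∈ K, DifferentiableAt ℝ H u) (hc : ContinuousOn (energyField G H) K)
    {σ : ℝ → ℝ} (hσ : IsSobolevSmooth 1 2 σ) (hσ0 : σ ≠ 0) {ε : ℝ} (hε : 0 < ε) :
    ∃ net : NeuralNetwork N,
      ∀ u ∈ K, ‖energyField G H u - energyField G (net.toFun σ) u‖ ≤ ε := by
  obtain ⟨f, hf, hfK⟩ := exists_contDiff_energyField_approx G hK hH hc (half_pos hε)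
  set C := ‖(Matrix.toEuclideanLin G).toContinuousLinearMap‖ with hC
  have hC0 : 0 ≤ C := norm_nonneg _
  obtain ⟨q, hq, hqK⟩ := hσ.exists_mem_ridgeSpan_iteratedFDeriv hσ0 (m := 1) hσ.contDiff hf hK
    (ε := ε / 2 / (C + 1)) (by positivity)
  obtain ⟨net, rfl⟩ := exists_toFun_eq_of_mem_ridgeSpan hq
  refine ⟨net, fun u hu => ?_⟩
  have h1 := hfK u hu
  have h2 : ‖energyField G f u - energyField G (net.toFun σ) u‖ ≤ ε / 2 := by
    calc _ ≤ C * ‖iteratedFDeriv ℝ 1 f u - iteratedFDeriv ℝ 1 (net.toFun σ) u‖ :=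
          norm_energyField_sub_le G u
      _ ≤ (C + 1) * (ε / 2 / (C + 1)) :=
          mul_le_mul (by linarith) (hqK 1 le_rfl u hu).le (norm_nonneg _) (by positivity)
      _ = ε / 2 := by field_simp
  have h3 := norm_sub_le_norm_sub_add_norm_sub (energyField G H u) (energyField G f u)
    (energyField G (net.toFun σ) u)
  linarith

end EnergyField

end

theorem theorem4 {N : ℕ} (G : Matrix (Fin N) (Fin N) ℝ)
    (hG : G.transpose = -G ∨ IsUnit G.det)
    (H : EuclideanSpace ℝ (Fin N) → ℝ) (K : Set (EuclideanSpace ℝ (Fin N)))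
    (hK : IsCompact K) (hH : ∀ u ∈ K, DifferentiableAt ℝ H u)
    (hLip : ∃ L : ℝ≥0, LipschitzOnWith L (energyField G H) K)
    (σ : ℝ → ℝ) (hσ : IsSobolevSmooth 1 2 σ) (hσ0 : σ ≠ 0) :
    (∀ ε : ℝ, 0 < ε → ∃ net : NeuralNetwork N,
      eLpNorm (fun u => energyField G H u - energyField G (net.toFun σ) u) 2
        (volume.restrict K) < ENNReal.ofReal ε) ∧
    (ContDiff ℝ ∞ H → ∀ n : ℕ∞, ContDiff ℝ n σ →
      ∀ m : ℕ, (m : ℕ∞) ≤ n → ∀ ε : ℝ, 0 < ε → ∃ net : NeuralNetwork N,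
        ContDiff ℝ n (net.toFun σ) ∧
        ∀ k : ℕ, k ≤ m → ∀ u ∈ K,
          ‖iteratedFDeriv ℝ k H u - iteratedFDeriv ℝ k (net.toFun σ) u‖ < ε) := by
  refine ⟨fun ε hε => ?_, fun hHs n hn m hm ε hε => ?_⟩
  · obtain ⟨L, hL⟩ := hLip
    let V : ℝ≥0∞ := (volume.restrict K) Set.univ ^ (2 : ℝ≥0∞).toReal⁻¹
    have hV : V ≠ ⊤ := by
      refine ENNReal.rpow_ne_top_of_nonneg (by positivity) ?_
      rw [Measure.restrict_apply_univ]
      exact hK.measure_lt_top.ne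
    obtain ⟨net, hnet⟩ := exists_network_energyField_approx G hK hH hL.continuousOn hσ hσ0
      (ε := ε / (V.toReal + 1)) (by positivity)
    refine ⟨net, ?_⟩
    calc _ ≤ V * ENNReal.ofReal (ε / (V.toReal + 1)) := by
          refine eLpNorm_le_of_ae_bound ?_
          filter_upwards [ae_restrict_mem hK.isClosed.measurableSet] with u hu using hnet u hu
      _ = ENNReal.ofReal (V.toReal * (ε / (V.toReal + 1))) := by
          rw [ENNReal.ofReal_mul ENNReal.toReal_nonneg, ENNReal.ofReal_toReal hV]
      _ < ENNReal.ofReal ε := by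
          refine (ENNReal.ofReal_lt_ofReal_iff hε).2 ?_
          rw [mul_div_assoc', div_lt_iff₀ (by positivity)]
          nlinarith [ENNReal.toReal_nonneg (a := V)]
  · obtain ⟨q, hq, hqK⟩ := hσ.exists_mem_ridgeSpan_iteratedFDeriv hσ0 (m := m)
      (hn.of_le (by exact_mod_cast hm)) hHs hK hε
    obtain ⟨net, rfl⟩ := exists_toFun_eq_of_mem_ridgeSpan hq
    exact ⟨net, contDiff_of_mem_ridgeSpan hn hq, hqK⟩
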